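/- For a rational number $q$ let $\mathrm{len}(q)$ be its representation length (bits of sign, numerator and denominator), extended to vectors and matrices by summing over the entries. $\|\cdot\|$ is the spectral norm, $\kappa(A)=\lambda_{\max}(A)/\lambda_{\min}(A)$ is the condition number of a symmetric positive definite matrix, and $d_{\mathrm{TV}}(P,Q)=\sup_A|P(A)-Q(A)|$ is the total variation distance. Let $\delta_0>0$. An approximate diagonalization oracle takes a symmetric positive definite $A\in\mathbb{Q}^{m\times m}$ and a rational $0<\delta\le\delta_0$, and returns a rational diagonal matrix $\Lambda^{1/2}$ with nonnegative entries and a matrix $Q\in\mathbb{Q}^{m\times m}$, all of whose singular values lie in $[1-\delta/3,1+\delta/3]$, such that $\|A-Q\Lambda Q^{T}\|\le\delta\|A\|$, where $\Lambda=(\Lambda^{1/2})^2$; the length of the answer is at most a fixed polynomial in $m$, $\mathrm{len}(A)$, $\mathrm{len}(\delta)$. Equal queries may be answered differently at different times. Theorem. There are a single algorithm (a program performing rational arithmetic $+,-,\times,/$, comparisons and bounded loops at unit cost, with access to such an oracle; one program for all dimensions, inputs and oracles) and constants $C$, $c>0$ (rational) and $k\geq 1$, all depending only on $\delta_0$, with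 the following property. The input consists of $n$, a rational $\epsilon>0$, vectors $\mu_1,\mu_2\in\mathbb{Q}^n$, positive definite matrices $\Sigma_1,\Sigma_2\in\mathbb{Q}^{n\times n}$, a rational $\Delta$ with $$0<\Delta\le D:=d_{\mathrm{TV}}(\mathcal N(\mu_1,\Sigma_1),\mathcal N(\mu_2,\Sigma_2)),$$ and a rational $\kappa>1$ with $\kappa(\Sigma_1),\kappa(\Sigma_2)\le\kappa$. The algorithm returns $\mu\in\mathbb{Q}^n$ and a diagonal positive definite $\Sigma\in\mathbb{Q}^{n\times n}$ such that $$\bigl|D-d_{\mathrm{TV}}(\mathcal N(\mu,\Sigma),\mathcal N(0,I_n))\bigr|\le\frac{\epsilon}{100}\,D .$$ It executes at most $Cn^3$ steps (arithmetic operations, comparisons, assignments of constants, loop control, oracle calls) and makes exactly two oracle calls, both on $n\times n$ symmetric positive definite matrices, with error parameter $$\delta=c\left(\frac{\min(\epsilon,1)\,\Delta}{n\kappa}\right)^{k}.$$ The representation length of both query matrices is at most $r\bigl(n+\mathrm{len}(\mu_1,\mu_2,\Sigma_1,\Sigma_2)+\mathrm{len}(\delta)\bigr)$ for a polynomial $r$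 that depends only on $\delta_0$ and on the polynomial that bounds the lengths of the oracle's answers. -/

import Mathlib

open MeasureTheory ProbabilityTheory

namespace GaussTV

/-! ### Total variation distance, Gaussians, condition number -/

/-- Total variation distance `sup_A |P(A) - Q(A)|` over measurable sets `A`
(used for probability measures). -/
noncomputable def tvDist {α : Type*} [MeasurableSpace α] (P Q : Measure α) : ℝ :=
  ⨆ A : {A : Set α // MeasurableSet A}, |P.real A - Q.real A|

/-- A rational matrix, seen as a real matrix. -/
noncomputable def toReal {n : ℕ} (A : Matrix (Fin n) (Fin n) ℚ) : Matrix (Fin n) (Fin n) ℝ :=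
  A.map (fun q : ℚ => (q : ℝ))

/-- The Gaussian law `N(μ, Σ)` on `ℝⁿ`, for rational parameters. -/
noncomputable def gaussian {n : ℕ} (μ : Fin n → ℚ) (S : Matrix (Fin n) (Fin n) ℚ) :
    Measure (EuclideanSpace ℝ (Fin n)) :=
  multivariateGaussian (WithLp.toLp 2 fun i => (μ i : ℝ)) (toReal S)

/-- Spectral norm: the operator norm with respect to the Euclidean norm. -/
noncomputable def specNorm {n : ℕ} (A : Matrix (Fin n) (Fin n) ℝ) : ℝ :=
  ‖Matrix.toEuclideanCLM (𝕜 := ℝ) A‖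

/-- `λ_max / λ_min`, for a positive definite matrix. -/
noncomputable def condNumber {n : ℕ} (A : Matrix (Fin n) (Fin n) ℝ) : ℝ :=
  sSup (spectrum ℝ A) / sInf (spectrum ℝ A)

/-! ### Representation length -/

/-- Bits needed to write a rational number: sign, numerator, denominator. -/
def len (q : ℚ) : ℕ := 1 + Nat.size q.num.natAbs + Nat.size q.den

def lenVec {n : ℕ} (v : Fin n → ℚ) : ℕ := ∑ i, len (v i)

def lenMat {n : ℕ} (A : Matrix (Fin n) (Fin n) ℚ) : ℕ := ∑ i, ∑ j, len (A i j)

/-! ### Approximate diagonalization oracles -/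

/-- An oracle answers the `k`-th query (`k = 0, 1, …`), which consists of a dimension `m`, a rational
`m × m` matrix `A` and an error parameter `δ`, by the diagonal of a matrix `Λ^{1/2}` and a
matrix `Q`.  Equal queries may be answered differently at different times. -/
abbrev Oracle : Type :=
  (k m : ℕ) → Matrix (Fin m) (Fin m) ℚ → ℚ → (Fin m → ℚ) × Matrix (Fin m) (Fin m) ℚ

/-- `(Λ^{1/2}, Q)`, the first given by its diagonal `l`, is a `δ`-approximate diagonalization of
`A`: `Λ^{1/2}` is nonnegative, the singular values of `Q` lie in `[1 - δ/3, 1 + δ/3]`, and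
`‖A - Q Λ Qᵀ‖ ≤ δ ‖A‖`. -/
structure IsApproxDiag {m : ℕ} (A : Matrix (Fin m) (Fin m) ℚ) (δ : ℚ)
    (l : Fin m → ℚ) (Q : Matrix (Fin m) (Fin m) ℚ) : Prop where
  nonneg : ∀ i, 0 ≤ l i
  singular : ∀ i < m, (Matrix.toEuclideanLin (toReal Q)).singularValues i ∈
    Set.Icc (1 - (δ : ℝ) / 3) (1 + (δ : ℝ) / 3)
  error : specNorm (toReal (A - Q * Matrix.diagonal (fun i => l i ^ 2) * Q.transpose)) ≤
    (δ : ℝ) * specNorm (toReal A)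

/-- `O` is an approximate diagonalization oracle for symmetric positive definite matrices and
errors `0 < δ ≤ δ₀` (the threshold `δ₀` makes "`δ` small enough" explicit).  An answer that is
produced with polynomially many bit operations has polynomial length; `p` is this polynomial. -/
def Oracle.Valid (O : Oracle) (δ₀ : ℝ) (p : Polynomial ℕ) : Prop :=
  ∀ (k m : ℕ) (A : Matrix (Fin m) (Fin m) ℚ) (δ : ℚ),
    (toReal A).PosDef → 0 < δ → (δ : ℝ) ≤ δ₀ →
      IsApproxDiag A δ (O k m A δ).1 (O k m A δ).2 ∧
      lenVec (O k m A δ).1 + lenMat (O k m A δ).2 ≤ p.eval (m + lenMat A + len δ)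

/-! ### The machine model

Programs over the rationals with unit cost.  The memory holds two-dimensional arrays of
rationals, addressed by an array name and two indices; index registers hold natural numbers and
serve as loop counters.  A program is one fixed finite object, for all dimensions and inputs. -/

/-- An index: a literal or the content of an index register. -/
inductive Idx
  | lit (k : ℕ)
  | reg (v : ℕ)

/-- A memory cell `name[row][col]`. -/
structure Cell where
  name : ℕ
  row : Idx
  col : Idx

inductive ArithOp
  | add | sub | mul | div

/-- Division by `0` yields `0`. -/
def ArithOp.eval : ArithOp → ℚ → ℚ → ℚ
  | .add, x, y => x + y
  | .sub, x, y => x - y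
  | .mul, x, y => x * y
  | .div, x, y => x / y

inductive Prog
  /-- do nothing -/
  | skip
  /-- store a constant in `dst` -/
  | const (dst : Cell) (q : ℚ)
  /-- `dst := a op b` -/
  | arith (op : ArithOp) (dst a b : Cell)
  /-- run the first program, then the second -/
  | seq (P₁ P₂ : Prog)
  /-- if `a ≤ b` then run the first program, else the second -/
  | ifLe (a b : Cell) (P₁ P₂ : Prog)
  /-- run `body` with register `v` equal to `0, 1, …, bound - 1` in turn -/
  | loop (v : ℕ) (bound : Idx) (body : Prog)
  /-- call the oracle on the upper left `dim × dim` block of the array `src`, with the error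
  parameter stored in `err`; write the diagonal matrix `Λ^{1/2}` to the upper left block of the
  array `dstL` and `Q` to that of `dstQ` -/
  | diag (dim : Idx) (src : ℕ) (err : Cell) (dstL dstQ : ℕ)

/-- A record of one oracle call. -/
structure Query where
  dim : ℕ
  mat : Matrix (Fin dim) (Fin dim) ℚ
  err : ℚ

structure State where
  /-- contents of the index registers -/
  reg : ℕ → ℕ
  /-- contents of the arrays -/
  mem : ℕ → ℕ → ℕ → ℚ
  /-- number of steps (arithmetic operations, comparisons, assignments of constants, loop control,
  oracle calls) executed so far -/
  steps : ℕ
  /-- oracle calls made so far -/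
  queries : List Query

namespace State

def idx (s : State) : Idx → ℕ
  | .lit k => k
  | .reg v => s.reg v

def get (s : State) (c : Cell) : ℚ := s.mem c.name (s.idx c.row) (s.idx c.col)

def set (s : State) (c : Cell) (q : ℚ) : State :=
  { s with mem := fun a i j =>
      if a = c.name ∧ i = s.idx c.row ∧ j = s.idx c.col then q else s.mem a i j }

def setReg (s : State) (v k : ℕ) : State :=
  { s with reg := Function.update s.reg v k }

def tick (s : State) : State := { s with steps := s.steps + 1 }

/-- The upper left `m × m` block of the array `a`. -/
def block (s : State) (a m : ℕ) : Matrix (Fin m) (Fin m) ℚ :=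
  Matrix.of fun i j => s.mem a i j

/-- The first `m` entries of column `0` of the array `a`. -/
def column (s : State) (a m : ℕ) : Fin m → ℚ := fun i => s.mem a i 0

def setBlock (s : State) (a : ℕ) {m : ℕ} (A : Matrix (Fin m) (Fin m) ℚ) : State :=
  { s with mem := fun b i j =>
      if h : b = a ∧ i < m ∧ j < m then A ⟨i, h.2.1⟩ ⟨j, h.2.2⟩ else s.mem b i j }

end State

/-- Execution of a program, from a state to the final state. -/
def Prog.run (O : Oracle) : Prog → State → State
  | .skip, s => s
  | .const dst q, s => (s.set dst q).tick
  | .arith op dst a b, s => (s.set dst (op.eval (s.get a) (s.get b))).tick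
  | .seq P₁ P₂, s => P₂.run O (P₁.run O s)
  | .ifLe a b P₁ P₂, s => if s.get a ≤ s.get b then P₁.run O s.tick else P₂.run O s.tick
  | .loop v bound body, s =>
      (List.range (s.idx bound)).foldl (fun t i => body.run O (t.setReg v i).tick) s.tick
  | .diag dim src err dstL dstQ, s =>
      let m := s.idx dim
      let q : Query := ⟨m, s.block src m, s.get err⟩
      let ans := O s.queries.length m q.mat q.err
      { (((s.setBlock dstL (Matrix.diagonal ans.1)).setBlock dstQ ans.2).tick) with
        queries := s.queries ++ [q] }

/-- An input: `ε`, the parameters of two Gaussians on `ℝⁿ`, and the bounds `Δ` and `κ`. -/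
structure Input (n : ℕ) where
  ε : ℚ
  μ₁ : Fin n → ℚ
  S₁ : Matrix (Fin n) (Fin n) ℚ
  μ₂ : Fin n → ℚ
  S₂ : Matrix (Fin n) (Fin n) ℚ
  Δ : ℚ
  κ : ℚ

namespace Input

/-- The distance `D` to be preserved. -/
noncomputable def D {n : ℕ} (x : Input n) : ℝ :=
  tvDist (gaussian x.μ₁ x.S₁) (gaussian x.μ₂ x.S₂)

/-- What the algorithm is promised about its input. -/
structure Admissible {n : ℕ} (x : Input n) : Prop where
  eps_pos : 0 < x.ε
  posDef₁ : (toReal x.S₁).PosDef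
  posDef₂ : (toReal x.S₂).PosDef
  Δ_pos : 0 < x.Δ
  Δ_le : (x.Δ : ℝ) ≤ x.D
  one_lt_κ : 1 < x.κ
  cond₁ : condNumber (toReal x.S₁) ≤ x.κ
  cond₂ : condNumber (toReal x.S₂) ≤ x.κ

/-- Representation length of `(μ₁, μ₂, Σ₁, Σ₂)`. -/
def length {n : ℕ} (x : Input n) : ℕ :=
  lenVec x.μ₁ + lenVec x.μ₂ + lenMat x.S₁ + lenMat x.S₂

/-- The initial state: register `0` holds `n`; array `0` holds `ε, Δ, κ` in its row `0`; arrays `1`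
and `3` hold `μ₁` and `μ₂` in their column `0`; arrays `2` and `4` hold `Σ₁` and `Σ₂`; everything
else is `0`. -/
def init {n : ℕ} (x : Input n) : State where
  reg := fun v => if v = 0 then n else 0
  mem := fun a i j =>
    if a = 0 then
      (if i = 0 ∧ j = 0 then x.ε else if i = 0 ∧ j = 1 then x.Δ
        else if i = 0 ∧ j = 2 then x.κ else 0)
    else if a = 1 then (if h : i < n ∧ j = 0 then x.μ₁ ⟨i, h.1⟩ else 0)
    else if a = 2 then (if h : i < n ∧ j < n then x.S₁ ⟨i, h.1⟩ ⟨j, h.2⟩ else 0)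
    else if a = 3 then (if h : i < n ∧ j = 0 then x.μ₂ ⟨i, h.1⟩ else 0)
    else if a = 4 then (if h : i < n ∧ j < n then x.S₂ ⟨i, h.1⟩ ⟨j, h.2⟩ else 0)
    else 0
  steps := 0
  queries := []

end Input

/-- The output vector `μ`: column `0` of the array `5`. -/
def State.outMean (s : State) (n : ℕ) : Fin n → ℚ := s.column 5 n

/-- The output matrix `Σ`: the array `6`. -/
def State.outCov (s : State) (n : ℕ) : Matrix (Fin n) (Fin n) ℚ := s.block 6 n

end GaussTV

/-! Total variation distance is unchanged by an invertible affine map. With an exact diagonalization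
`Σ₂ = Q Λ Qᵀ`, put `B = Q Λ^{-1/2}`; then `Bᵀ Σ₂ B = 1`. If `Q'` diagonalizes `Bᵀ Σ₁ B` as `Λ'`, the
map `T = Q'ᵀ Bᵀ` takes the two covariances to `Λ'` and `1`, and two diagonalizations suffice.

With approximate answers `T` is still invertible, so applying it costs nothing
(`tvDist_gaussian_eq`). The only loss comes from replacing `T Σ₁ Tᵀ` by `Λ'` and `T Σ₂ Tᵀ` by `1`.
The oracle's error is absolute, `δ ‖A‖`; measured against the smallest eigenvalue it becomes a
relative error of order `δ κ(A)` between the quadratic forms of `Qᵀ A Q` and `Λ`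
(`approx_diag_form_bounds`, `approx_diag_form_error`). The second query has condition number at most
`9 κ²` (`whitening_form_bounds`), so all relative errors are `O(δ κ²)`.

A relative error `η` in the covariance moves a Gaussian law by at most `3 n η`
(`tvDist_near_standard`). This follows from the density: for a contraction `M`, the law of `M X` is
dominated by `|det M|⁻¹` times that of the standard Gaussian `X`, and domination bounds the distance
by `1 - |det M|`. Two laws are compared by shrinking both until they are images of `X` under
contractions. Altogether the error is at most `400 n δ κ²` (`reduction_accuracy`), which the choice
of `δ`, together with `Δ ≤ D`, turns into a multiple of `ε D`.

The program consists of a bounded number of matrix products and entrywise operations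
(`run_reduction`). The length of the second query is controlled by `height`, which is
submultiplicative under addition and multiplication and does not grow under inversion. -/

namespace GaussTV

/-! ### Total variation distance: triangle inequality, images, domination. -/

section TotalVariation

variable {α β : Type*} [MeasurableSpace α] [MeasurableSpace β]

lemma bddAbove_tvDist (P Q : Measure α) [IsProbabilityMeasure P] [IsProbabilityMeasure Q] :
    BddAbove (Set.range fun A : {A : Set α // MeasurableSet A} => |P.real A - Q.real A|) := by
  refine ⟨1, ?_⟩
  rintro _ ⟨A, rfl⟩
  have h1 := measureReal_le_one (μ := P) (s := (A : Set α))
  have h2 := measureReal_le_one (μ := Q) (s := (A : Set α))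
  have h3 := measureReal_nonneg (μ := P) (s := (A : Set α))
  have h4 := measureReal_nonneg (μ := Q) (s := (A : Set α))
  exact abs_le.2 ⟨by linarith, by linarith⟩

lemma abs_sub_le_tvDist (P Q : Measure α) [IsProbabilityMeasure P] [IsProbabilityMeasure Q]
    {A : Set α} (hA : MeasurableSet A) : |P.real A - Q.real A| ≤ tvDist P Q :=
  le_ciSup (bddAbove_tvDist P Q) (⟨A, hA⟩ : {A : Set α // MeasurableSet A})

lemma tvDist_le {P Q : Measure α} {b : ℝ}
    (h : ∀ A, MeasurableSet A → |P.real A - Q.real A| ≤ b) : tvDist P Q ≤ b :=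
  haveI : Nonempty {A : Set α // MeasurableSet A} := ⟨⟨∅, MeasurableSet.empty⟩⟩
  ciSup_le fun A => h A A.2

lemma tvDist_le_one (P Q : Measure α) [IsProbabilityMeasure P] [IsProbabilityMeasure Q] :
    tvDist P Q ≤ 1 := by
  refine tvDist_le fun A _ => ?_
  have h1 := measureReal_le_one (μ := P) (s := A)
  have h2 := measureReal_le_one (μ := Q) (s := A)
  have h3 := measureReal_nonneg (μ := P) (s := A)
  have h4 := measureReal_nonneg (μ := Q) (s := A)
  exact abs_le.2 ⟨by linarith, by linarith⟩

lemma tvDist_comm (P Q : Measure α) : tvDist P Q = tvDist Q P := by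
  unfold tvDist
  simp_rw [abs_sub_comm]

lemma tvDist_triangle (P Q R : Measure α) [IsProbabilityMeasure P] [IsProbabilityMeasure Q]
    [IsProbabilityMeasure R] : tvDist P R ≤ tvDist P Q + tvDist Q R :=
  tvDist_le fun _ hA => (abs_sub_le _ _ _).trans
    (add_le_add (abs_sub_le_tvDist P Q hA) (abs_sub_le_tvDist Q R hA))

lemma abs_tvDist_sub_le (P Q P' Q' : Measure α) [IsProbabilityMeasure P] [IsProbabilityMeasure Q]
    [IsProbabilityMeasure P'] [IsProbabilityMeasure Q'] :
    |tvDist P Q - tvDist P' Q'| ≤ tvDist P P' + tvDist Q Q' := by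
  have h1 := tvDist_triangle P P' Q
  have h2 := tvDist_triangle P' Q' Q
  have h3 := tvDist_triangle P' P Q'
  have h4 := tvDist_triangle P Q Q'
  rw [tvDist_comm Q' Q] at h2
  rw [tvDist_comm P' P] at h3
  exact abs_le.2 ⟨by linarith, by linarith⟩

lemma tvDist_map_le (P Q : Measure α) [IsProbabilityMeasure P] [IsProbabilityMeasure Q]
    {f : α → β} (hf : Measurable f) : tvDist (P.map f) (Q.map f) ≤ tvDist P Q := by
  refine tvDist_le fun A hA => ?_
  rw [map_measureReal_apply hf hA, map_measureReal_apply hf hA]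
  exact abs_sub_le_tvDist P Q (hf hA)

/-- Images under measurable maps do not increase the distance; this applies to `f` and to the map
`g` that undoes it. -/
lemma tvDist_map_of_leftInverse (P Q : Measure α) [IsProbabilityMeasure P] [IsProbabilityMeasure Q]
    {f : α → β} {g : β → α} (hf : Measurable f) (hg : Measurable g)
    (hgf : Function.LeftInverse g f) : tvDist (P.map f) (Q.map f) = tvDist P Q := by
  refine le_antisymm (tvDist_map_le P Q hf) ?_
  have := Measure.isProbabilityMeasure_map (μ := P) hf.aemeasurable
  have := Measure.isProbabilityMeasure_map (μ := Q) hf.aemeasurable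
  have h := tvDist_map_le (P.map f) (Q.map f) hg
  rwa [Measure.map_map hg hf, Measure.map_map hg hf, hgf.comp_eq_id, Measure.map_id,
    Measure.map_id] at h

/-- Domination of one probability measure by a multiple of another one bounds their distance. -/
lemma tvDist_le_of_mul_le (P Q : Measure α) [IsProbabilityMeasure P] [IsProbabilityMeasure Q]
    {a : ℝ} (h : ∀ A, MeasurableSet A → a * P.real A ≤ Q.real A) : tvDist P Q ≤ 1 - a := by
  have ha : a ≤ 1 := by simpa using h Set.univ MeasurableSet.univ
  refine tvDist_le fun A hA => ?_
  have h1 := measureReal_le_one (μ := P) (s := A)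
  have h3 := measureReal_nonneg (μ := P) (s := A)
  have h5 := h A hA
  -- The set `A` bounds `P A - Q A`; its complement bounds `Q A - P A`.
  have h6 := h Aᶜ hA.compl
  rw [probReal_compl_eq_one_sub hA, probReal_compl_eq_one_sub hA] at h6
  exact abs_le.2 ⟨by nlinarith, by nlinarith⟩

end TotalVariation

/-! ### The Gaussian density and images under contractions. -/

section Density

variable {E : Type*} [NormedAddCommGroup E] [InnerProductSpace ℝ E] [FiniteDimensional ℝ E]
  [MeasurableSpace E] [BorelSpace E]

open Complex in
/-- The standard Gaussian measure has a radial density. -/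
lemma stdGaussian_eq_withDensity :
    stdGaussian E = volume.withDensity (fun x : E => ENNReal.ofReal
      (((2 * Real.pi) ^ (Module.finrank ℝ E / 2 : ℝ))⁻¹ * Real.exp (-‖x‖ ^ 2 / 2))) := by
  set C : ℝ := ((2 * Real.pi) ^ (Module.finrank ℝ E / 2 : ℝ))⁻¹ with hC
  have hC0 : 0 < C := by positivity
  have hint : Integrable (fun x : E => C * Real.exp (-‖x‖ ^ 2 / 2)) := by
    have := GaussianFourier.integrable_cexp_neg_mul_sq_norm_add (V := E) (b := 1 / 2)
      (by norm_num) 0 0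
    have h2 := this.norm.const_mul C
    refine h2.congr (Filter.Eventually.of_forall fun x => ?_)
    simp only [Complex.norm_exp]
    congr 2
    simp [← ofReal_pow]
    ring
  have hfin : IsFiniteMeasure (volume.withDensity (fun x : E => ENNReal.ofReal
      (C * Real.exp (-‖x‖ ^ 2 / 2)))) := isFiniteMeasure_withDensity_ofReal hint.2
  apply Measure.ext_of_charFun
  ext t
  rw [charFun_stdGaussian, charFun_apply, integral_withDensity_eq_integral_toReal_smul]
  · have h := GaussianFourier.integral_cexp_neg_mul_sq_norm_add (V := E) (b := 1 / 2)
      (by norm_num) I t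
    have h3 : ∀ x : E, (ENNReal.ofReal (C * Real.exp (-‖x‖ ^ 2 / 2))).toReal •
        cexp (inner ℝ x t * I) =
        (C : ℂ) * cexp (-(1 / 2) * (‖x‖ : ℂ) ^ 2 + I * (inner ℝ t x : ℝ)) := by
      intro x
      rw [ENNReal.toReal_ofReal (by positivity), real_smul, ofReal_mul, mul_assoc, ofReal_exp,
        ← Complex.exp_add, real_inner_comm]
      congr 2
      push_cast
      ring
    simp_rw [h3]
    rw [integral_const_mul, h, ← mul_assoc]
    have h4 : (C : ℂ) * (Real.pi / (1 / 2) : ℂ) ^ (Module.finrank ℝ E / 2 : ℂ) = 1 := by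
      have : (Real.pi / (1 / 2) : ℂ) = ((2 * Real.pi : ℝ) : ℂ) := by push_cast; ring
      rw [this]
      have h5 : (Module.finrank ℝ E / 2 : ℂ) = ((Module.finrank ℝ E / 2 : ℝ) : ℂ) := by
        push_cast; ring
      rw [h5, ← ofReal_cpow (by positivity), ← ofReal_mul, hC, inv_mul_cancel₀ (by positivity)]
      simp
    rw [h4, one_mul]
    congr 1
    rw [I_sq]
    ring
  · fun_prop
  · exact Filter.Eventually.of_forall fun x => ENNReal.ofReal_lt_top

/-- Contracting a standard Gaussian vector moves its law only as far as the determinant says. -/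
lemma tvDist_map_stdGaussian_le (M : E →ₗ[ℝ] E) (hM : ∀ x, ‖M x‖ ≤ ‖x‖)
    (hdet : LinearMap.det M ≠ 0) :
    tvDist ((stdGaussian E).map M) (stdGaussian E) ≤ 1 - |LinearMap.det M| := by
  have hMm : Measurable M := (LinearMap.continuous_of_finiteDimensional M).measurable
  have := Measure.isProbabilityMeasure_map (μ := stdGaussian E) hMm.aemeasurable
  refine tvDist_le_of_mul_le _ _ fun A hA => ?_
  set φ : E → ENNReal := fun x : E => ENNReal.ofReal
      (((2 * Real.pi) ^ (Module.finrank ℝ E / 2 : ℝ))⁻¹ * Real.exp (-‖x‖ ^ 2 / 2)) with hφ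
  have hφm : Measurable φ := by fun_prop
  have key : (stdGaussian E) (M ⁻¹' A) ≤
      ENNReal.ofReal |(LinearMap.det M)⁻¹| * stdGaussian E A := by
    rw [stdGaussian_eq_withDensity, withDensity_apply _ (hMm hA), withDensity_apply _ hA]
    -- The density decreases with the norm, so evaluating it at the shorter vector `M x` only
    -- increases it. The change of variables then contributes `|det M|⁻¹`.
    calc ∫⁻ x in M ⁻¹' A, φ x ≤ ∫⁻ x in M ⁻¹' A, φ (M x) := by
          refine lintegral_mono fun x => ?_
          refine ENNReal.ofReal_le_ofReal (mul_le_mul_of_nonneg_left ?_ (by positivity))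
          refine Real.exp_le_exp.2 ?_
          have := pow_le_pow_left₀ (norm_nonneg _) (hM x) 2
          linarith
      _ = ∫⁻ y in A, φ y ∂(Measure.map M volume) := by
          rw [setLIntegral_map hA hφm hMm]
      _ = _ := by
          rw [Measure.map_linearMap_addHaar_eq_smul_addHaar _ hdet, Measure.restrict_smul,
            lintegral_smul_measure, smul_eq_mul]
  rw [map_measureReal_apply hMm hA]
  have h2 := ENNReal.toReal_mono (by finiteness) key
  rw [ENNReal.toReal_mul, ENNReal.toReal_ofReal (abs_nonneg _), abs_inv] at h2
  have hpos : 0 < |LinearMap.det M| := abs_pos.2 hdet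
  calc |LinearMap.det M| * (stdGaussian E).real (M ⁻¹' A)
      ≤ |LinearMap.det M| * (|LinearMap.det M|⁻¹ * (stdGaussian E A).toReal) :=
        mul_le_mul_of_nonneg_left h2 hpos.le
    _ = (stdGaussian E).real A := by
        rw [← mul_assoc, mul_inv_cancel₀ hpos.ne', one_mul]; rfl

end Density

/-! ### Gaussian laws with nearly equal covariances. -/

section GaussianPerturbation

open Matrix

variable {n : ℕ}

lemma inner_toEuclideanCLM_left (T : Matrix (Fin n) (Fin n) ℝ) (x t : EuclideanSpace ℝ (Fin n)) :
    inner ℝ (toEuclideanCLM (𝕜 := ℝ) T x) t = inner ℝ x (toEuclideanCLM (𝕜 := ℝ) Tᵀ t) := by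
  rw [← conjTranspose_eq_transpose_of_trivial, ← star_eq_conjTranspose, map_star,
    ContinuousLinearMap.star_eq_adjoint, ContinuousLinearMap.adjoint_inner_right]

open Complex in
/-- Affine images of Gaussian laws. -/
lemma map_multivariateGaussian (μ ν : EuclideanSpace ℝ (Fin n)) (S T : Matrix (Fin n) (Fin n) ℝ)
    (hS : S.PosSemidef) :
    (multivariateGaussian μ S).map (fun x => ν + toEuclideanCLM (𝕜 := ℝ) T x) =
      multivariateGaussian (ν + toEuclideanCLM (𝕜 := ℝ) T μ) (T * S * Tᵀ) := by
  have hS' : (T * S * Tᵀ).PosSemidef := by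
    have := hS.mul_mul_conjTranspose_same T
    rwa [conjTranspose_eq_transpose_of_trivial] at this
  have hm : Measurable (fun x : EuclideanSpace ℝ (Fin n) => ν + toEuclideanCLM (𝕜 := ℝ) T x) := by
    fun_prop
  have := Measure.isProbabilityMeasure_map (μ := multivariateGaussian μ S) hm.aemeasurable
  apply Measure.ext_of_charFun
  ext t
  rw [charFun_multivariateGaussian hS', charFun_apply, integral_map hm.aemeasurable
    (Measurable.aestronglyMeasurable (by fun_prop))]
  have h1 : ∀ x, cexp ((inner ℝ (ν + toEuclideanCLM (𝕜 := ℝ) T x) t : ℝ) * I) =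
      cexp ((inner ℝ ν t : ℝ) * I) *
        cexp ((inner ℝ x (toEuclideanCLM (𝕜 := ℝ) Tᵀ t) : ℝ) * I) := by
    intro x
    rw [inner_add_left, inner_toEuclideanCLM_left, ← Complex.exp_add]
    congr 1
    push_cast
    ring
  simp_rw [h1]
  rw [integral_const_mul, ← charFun_apply, charFun_multivariateGaussian hS, ← Complex.exp_add]
  congr 1
  have h2 : (toEuclideanCLM (𝕜 := ℝ) Tᵀ t).ofLp ⬝ᵥ S *ᵥ (toEuclideanCLM (𝕜 := ℝ) Tᵀ t).ofLp =
      t.ofLp ⬝ᵥ (T * S * Tᵀ) *ᵥ t.ofLp := by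
    rw [← inner_toEuclideanCLM, ← inner_toEuclideanCLM, map_mul, map_mul]
    simp only [mul_apply_eq_comp]
    rw [inner_toEuclideanCLM_left Tᵀ, transpose_transpose]
  rw [h2, inner_add_right, inner_toEuclideanCLM_left Tᵀ, transpose_transpose, real_inner_comm ν t]
  push_cast
  ring

lemma pow_le_det_of_le {A : Matrix (Fin n) (Fin n) ℝ} (hA : A.IsHermitian) {a : ℝ} (ha : 0 ≤ a)
    (h : ∀ x : EuclideanSpace ℝ (Fin n), a * ‖x‖ ^ 2 ≤ inner ℝ x (toEuclideanCLM (𝕜 := ℝ) A x)) :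
    a ^ n ≤ A.det := by
  rw [hA.det_eq_prod_eigenvalues]
  have : a ^ n = ∏ _i : Fin n, a := by simp
  rw [this]
  refine Finset.prod_le_prod (fun _ _ => ha) fun i _ => ?_
  have h1 := h (hA.eigenvectorBasis i)
  rw [inner_toEuclideanCLM, hA.mulVec_eigenvectorBasis, (hA.eigenvectorBasis).orthonormal.1 i] at h1
  have h2 : (hA.eigenvectorBasis i).ofLp ⬝ᵥ (hA.eigenvectorBasis i).ofLp = 1 := by
    have := hA.eigenvectorBasis.orthonormal.1 i
    have h3 := EuclideanSpace.real_norm_sq_eq (hA.eigenvectorBasis i)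
    rw [this] at h3
    simp only [dotProduct, ← sq]
    linarith
  rw [dotProduct_smul, h2] at h1
  simpa using h1

lemma det_toEuclideanCLM (A : Matrix (Fin n) (Fin n) ℝ) :
    LinearMap.det ((toEuclideanCLM (𝕜 := ℝ) A : EuclideanSpace ℝ (Fin n) →L[ℝ] _) :
      EuclideanSpace ℝ (Fin n) →ₗ[ℝ] EuclideanSpace ℝ (Fin n)) = A.det := by
  rw [coe_toEuclideanCLM_eq_toEuclideanLin]
  exact LinearMap.det_toLpLin 2 A

open scoped MatrixOrder in
/-- A centred Gaussian law with covariance close to the identity is close to the standard one. -/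
lemma tvDist_near_standard {A : Matrix (Fin n) (Fin n) ℝ} (hA : A.PosSemidef) {η : ℝ}
    (hη : 0 ≤ η) (hη1 : η < 1)
    (hlo : ∀ x : EuclideanSpace ℝ (Fin n),
      (1 - η) * ‖x‖ ^ 2 ≤ inner ℝ x (toEuclideanCLM (𝕜 := ℝ) A x))
    (hhi : ∀ x : EuclideanSpace ℝ (Fin n),
      inner ℝ x (toEuclideanCLM (𝕜 := ℝ) A x) ≤ (1 + η) * ‖x‖ ^ 2) :
    tvDist (multivariateGaussian 0 A) (multivariateGaussian 0 1) ≤ 3 * n * η := by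
  set R : Matrix (Fin n) (Fin n) ℝ := CFC.sqrt A with hR
  have hRR : R * R = A := CFC.sqrt_mul_sqrt_self A hA.nonneg
  have hRs : Rᵀ = R := by
    have := (CFC.sqrt_nonneg A).isSelfAdjoint
    rw [← conjTranspose_eq_transpose_of_trivial]
    exact this
  have hRn : ∀ x : EuclideanSpace ℝ (Fin n),
      ‖toEuclideanCLM (𝕜 := ℝ) R x‖ ^ 2 = inner ℝ x (toEuclideanCLM (𝕜 := ℝ) A x) := by
    intro x
    rw [← real_inner_self_eq_norm_sq, inner_toEuclideanCLM_left, hRs, ← hRR, map_mul]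
    rfl
  -- Dividing by `s` makes both `√A` and the identity contractions; the common scaling is undone at
  -- the end.
  set s : ℝ := √(1 + η) with hs
  have hs0 : 0 < s := Real.sqrt_pos.2 (by linarith)
  have hss : s ^ 2 = 1 + η := Real.sq_sqrt (by linarith)
  have hs1 : 1 - η ≤ s⁻¹ := by
    have h1 : s ≤ 1 + η := by nlinarith
    rw [← one_div, le_div_iff₀ hs0]
    nlinarith
  have hs2 : s⁻¹ ≤ 1 := inv_le_one_of_one_le₀ (by nlinarith)
  set E := EuclideanSpace ℝ (Fin n)
  set M₁ : E →ₗ[ℝ] E := s⁻¹ • (toEuclideanCLM (𝕜 := ℝ) R : E →ₗ[ℝ] E) with hM₁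
  set M₂ : E →ₗ[ℝ] E := s⁻¹ • (LinearMap.id : E →ₗ[ℝ] E) with hM₂
  have hm₁ : Measurable M₁ := (LinearMap.continuous_of_finiteDimensional M₁).measurable
  have hm₂ : Measurable M₂ := (LinearMap.continuous_of_finiteDimensional M₂).measurable
  have hdet₂ : LinearMap.det M₂ = s⁻¹ ^ n := by simp [hM₂, E]
  have hdet₁ : LinearMap.det M₁ = s⁻¹ ^ n * R.det := by
    rw [hM₁, LinearMap.det_smul, det_toEuclideanCLM]
    simp [E]
  have hpow : 0 < (1 - η) ^ n := pow_pos (by linarith) n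
  have hpow1 : (1 - η) ^ n ≤ 1 := pow_le_one₀ (by linarith) (by linarith)
  -- In fact `|det R| ≥ (1 - η)^(n/2)`; since `1 - η ≤ 1` the weaker integer power is enough.
  have hdetR : (1 - η) ^ n ≤ |R.det| := by
    have h1 : (1 - η) ^ n ≤ A.det := pow_le_det_of_le hA.1 (by linarith) hlo
    rw [← hRR, det_mul, ← abs_mul_abs_self R.det] at h1
    have := abs_nonneg R.det
    nlinarith
  have hsn : (1 - η) ^ n ≤ s⁻¹ ^ n := pow_le_pow_left₀ (by linarith) hs1 n
  have hb₁ : tvDist ((stdGaussian E).map M₁) (stdGaussian E) ≤ 2 * n * η := by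
    refine (tvDist_map_stdGaussian_le M₁ (fun x => ?_) ?_).trans ?_
    · refine le_of_sq_le_sq ?_ (norm_nonneg _)
      have h1 : ‖M₁ x‖ ^ 2 = s⁻¹ ^ 2 * ‖toEuclideanCLM (𝕜 := ℝ) R x‖ ^ 2 := by
        simp [hM₁, norm_smul, mul_pow]
      rw [h1, hRn, inv_pow, hss, inv_mul_le_iff₀ (by linarith)]
      exact hhi x
    · rw [hdet₁]
      exact mul_ne_zero (by positivity) (abs_pos.1 (hpow.trans_le hdetR))
    · rw [hdet₁, abs_mul, abs_of_pos (by positivity)]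
      have h1 := mul_le_mul hsn hdetR hpow.le (by positivity)
      rw [← pow_add] at h1
      -- Bernoulli's inequality, with one exponent `n` from the scaling by `s⁻¹` and one from `det
      -- R`.
      have h2 := one_add_mul_le_pow (a := -η) (by linarith) (n + n)
      push_cast at h2
      rw [← sub_eq_add_neg] at h2
      linarith
  have hb₂ : tvDist ((stdGaussian E).map M₂) (stdGaussian E) ≤ n * η := by
    refine (tvDist_map_stdGaussian_le M₂ (fun x => ?_) ?_).trans ?_
    · simp only [hM₂, LinearMap.smul_apply, LinearMap.id_apply, norm_smul, norm_inv,
        Real.norm_of_nonneg hs0.le]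
      exact mul_le_of_le_one_left (norm_nonneg _) hs2
    · rw [hdet₂]; positivity
    · rw [hdet₂, abs_of_pos (by positivity)]
      have h2 := one_add_mul_le_pow (a := -η) (by linarith) n
      rw [← sub_eq_add_neg] at h2
      linarith
  have := Measure.isProbabilityMeasure_map (μ := stdGaussian E) hm₁.aemeasurable
  have := Measure.isProbabilityMeasure_map (μ := stdGaussian E) hm₂.aemeasurable
  have hms : Measurable (fun x : E => s • x) := by fun_prop
  have e₁ : multivariateGaussian 0 A = ((stdGaussian E).map M₁).map (fun x => s • x) := by
    rw [Measure.map_map hms hm₁, multivariateGaussian]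
    congr 1
    ext1 x
    simp [hM₁, smul_smul, hs0.ne', hR]
  have e₂ : multivariateGaussian 0 (1 : Matrix (Fin n) (Fin n) ℝ) =
      ((stdGaussian E).map M₂).map (fun x => s • x) := by
    rw [Measure.map_map hms hm₂, multivariateGaussian_zero_one]
    conv_lhs => rw [← Measure.map_id (μ := stdGaussian E)]
    congr 1
    ext1 x
    simp [hM₂, smul_smul, hs0.ne']
  rw [e₁, e₂]
  refine (tvDist_map_le _ _ hms).trans ((tvDist_triangle _ (stdGaussian E) _).trans ?_)
  rw [tvDist_comm (stdGaussian E)]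
  linarith

/-- Gaussian laws with the same mean and relatively close covariances, one of them diagonal. -/
lemma tvDist_near_diagonal (μ : EuclideanSpace ℝ (Fin n)) {A : Matrix (Fin n) (Fin n) ℝ}
    (hA : A.PosSemidef) {l : Fin n → ℝ} (hl : ∀ i, 0 < l i) {η : ℝ}
    (hη : 0 ≤ η) (hη1 : η < 1)
    (h : ∀ x : EuclideanSpace ℝ (Fin n),
      |inner ℝ x (toEuclideanCLM (𝕜 := ℝ) A x) - ‖toEuclideanCLM (𝕜 := ℝ) (diagonal l) x‖ ^ 2| ≤
        η * ‖toEuclideanCLM (𝕜 := ℝ) (diagonal l) x‖ ^ 2) :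
    tvDist (multivariateGaussian μ A) (multivariateGaussian μ (diagonal fun i => l i ^ 2)) ≤
      3 * n * η := by
  set L : Matrix (Fin n) (Fin n) ℝ := diagonal l
  set K : Matrix (Fin n) (Fin n) ℝ := diagonal fun i => (l i)⁻¹
  have hLK : L * K = 1 := by
    simp only [L, K, diagonal_mul_diagonal, mul_inv_cancel₀ (hl _).ne', diagonal_one]
  have hKL : K * L = 1 := by
    simp only [L, K, diagonal_mul_diagonal, inv_mul_cancel₀ (hl _).ne', diagonal_one]
  have hLt : Lᵀ = L := diagonal_transpose _
  have hKt : Kᵀ = K := diagonal_transpose _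
  have hLL : L * L = diagonal fun i => l i ^ 2 := by
    simp only [L, diagonal_mul_diagonal, sq]
  have hB : (K * A * Kᵀ).PosSemidef := by
    have := hA.mul_mul_conjTranspose_same K
    rwa [conjTranspose_eq_transpose_of_trivial] at this
  have hm : Measurable fun x : EuclideanSpace ℝ (Fin n) => μ + toEuclideanCLM (𝕜 := ℝ) L x := by
    fun_prop
  have e₁ := map_multivariateGaussian 0 μ (K * A * Kᵀ) L hB
  have e₂ := map_multivariateGaussian 0 μ 1 L PosSemidef.one
  have h₁ : L * (K * A * Kᵀ) * Lᵀ = A := by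
    rw [hKt, hLt]
    calc L * (K * A * K) * L = (L * K) * A * (K * L) := by simp only [Matrix.mul_assoc]
      _ = A := by rw [hLK, hKL, Matrix.one_mul, Matrix.mul_one]
  rw [h₁, map_zero, add_zero] at e₁
  rw [hLt, Matrix.mul_one, hLL, map_zero, add_zero] at e₂
  rw [← e₁, ← e₂]
  have hx : ∀ x : EuclideanSpace ℝ (Fin n),
      |inner ℝ x (toEuclideanCLM (𝕜 := ℝ) (K * A * Kᵀ) x) - ‖x‖ ^ 2| ≤ η * ‖x‖ ^ 2 := by
    intro x
    have h2 := h (toEuclideanCLM (𝕜 := ℝ) K x)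
    have h3 : toEuclideanCLM (𝕜 := ℝ) L (toEuclideanCLM (𝕜 := ℝ) K x) = x := by
      rw [← mul_apply_eq_comp, ← map_mul, hLK, map_one]; rfl
    rw [h3, inner_toEuclideanCLM_left] at h2
    rw [map_mul, map_mul]
    rw [hKt] at h2 ⊢
    exact h2
  refine (tvDist_map_le _ _ hm).trans (tvDist_near_standard hB hη hη1 (fun x => ?_) fun x => ?_)
  · have := (abs_le.1 (hx x)).1
    linarith
  · have := (abs_le.1 (hx x)).2
    linarith

end GaussianPerturbation

/-! ### Quadratic forms: eigenbases and approximate diagonalization. -/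

section QuadraticForms

variable {E : Type*} [NormedAddCommGroup E] [InnerProductSpace ℝ E]

section Spectral

variable {ι : Type*} [Fintype ι] (v : OrthonormalBasis ι ℝ E) {T : E →ₗ[ℝ] E}
  {ev : ι → ℝ}

lemma inner_apply_of_eigenbasis (hT : T.IsSymmetric) (hv : ∀ i, T (v i) = ev i • v i) (x : E)
    (i : ι) : inner ℝ (v i) (T x) = ev i * inner ℝ (v i) x := by
  rw [← hT, hv, real_inner_smul_left]

lemma inner_self_apply_of_eigenbasis (hT : T.IsSymmetric) (hv : ∀ i, T (v i) = ev i • v i)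
    (x : E) : inner ℝ x (T x) = ∑ i, ev i * inner ℝ (v i) x ^ 2 := by
  rw [← v.sum_inner_mul_inner]
  refine Finset.sum_congr rfl fun i _ => ?_
  rw [inner_apply_of_eigenbasis v hT hv, real_inner_comm]
  ring

lemma le_inner_of_eigenbasis (hT : T.IsSymmetric) (hv : ∀ i, T (v i) = ev i • v i) {a : ℝ}
    (ha : ∀ i, a ≤ ev i) (x : E) : a * ‖x‖ ^ 2 ≤ inner ℝ x (T x) := by
  rw [inner_self_apply_of_eigenbasis v hT hv, ← v.sum_sq_inner_right, Finset.mul_sum]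
  exact Finset.sum_le_sum fun i _ => mul_le_mul_of_nonneg_right (ha i) (sq_nonneg _)

lemma inner_le_of_eigenbasis (hT : T.IsSymmetric) (hv : ∀ i, T (v i) = ev i • v i) {b : ℝ}
    (hb : ∀ i, ev i ≤ b) (x : E) : inner ℝ x (T x) ≤ b * ‖x‖ ^ 2 := by
  rw [inner_self_apply_of_eigenbasis v hT hv, ← v.sum_sq_inner_right, Finset.mul_sum]
  exact Finset.sum_le_sum fun i _ => mul_le_mul_of_nonneg_right (hb i) (sq_nonneg _)

lemma norm_apply_le_of_eigenbasis (hT : T.IsSymmetric) (hv : ∀ i, T (v i) = ev i • v i) {b : ℝ}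
    (hb0 : 0 ≤ b) (hb : ∀ i, |ev i| ≤ b) (x : E) : ‖T x‖ ≤ b * ‖x‖ := by
  refine le_of_sq_le_sq ?_ (by positivity)
  rw [mul_pow, ← v.sum_sq_inner_right (T x), ← v.sum_sq_inner_right x, Finset.mul_sum]
  refine Finset.sum_le_sum fun i _ => ?_
  rw [inner_apply_of_eigenbasis v hT hv, mul_pow]
  exact mul_le_mul_of_nonneg_right (sq_le_sq.2 (by rw [abs_of_nonneg hb0]; exact hb i))
    (sq_nonneg _)

end Spectral

lemma abs_norm_sq_sub_le_of_near_isometry {q qt : E →ₗ[ℝ] E}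
    (hadj : ∀ x y, inner ℝ (q x) y = inner ℝ x (qt y)) {δ : ℝ}
    (hF : ∀ x, ‖qt (q x) - x‖ ≤ δ * ‖x‖) (x : E) : |‖q x‖ ^ 2 - ‖x‖ ^ 2| ≤ δ * ‖x‖ ^ 2 := by
  have h : ‖q x‖ ^ 2 - ‖x‖ ^ 2 = inner ℝ x (qt (q x) - x) := by
    rw [inner_sub_right, ← hadj, real_inner_self_eq_norm_sq, real_inner_self_eq_norm_sq]
  rw [h]
  refine (abs_real_inner_le_norm _ _).trans ?_
  have := mul_le_mul_of_nonneg_left (hF x) (norm_nonneg x)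
  linarith

variable {q qt L S : E →ₗ[ℝ] E} {δ a b : ℝ}

/-- The hypothesis `herr` sees `L` only through `qt`. Since `qt ∘ q` is within `δ < 1` of the
identity it is injective, hence surjective, and every vector is `qt (q z)` with norms of `z`, `q z`
and `qt (q z)` comparable. Evaluating `herr` at `q z` then gives bounds on `L` itself. -/
lemma approx_diag_form_bounds [FiniteDimensional ℝ E]
    (hadj : ∀ x y, inner ℝ (q x) y = inner ℝ x (qt y))
    (hδ : δ ≤ 1 / 10) (ha : 0 < a) (hδb : δ * b ≤ a / 10) (hab : a ≤ b)
    (hF : ∀ x, ‖qt (q x) - x‖ ≤ δ * ‖x‖)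
    (hlo : ∀ x, a * ‖x‖ ^ 2 ≤ inner ℝ x (S x)) (hhi : ∀ x, inner ℝ x (S x) ≤ b * ‖x‖ ^ 2)
    (herr : ∀ x, |inner ℝ x (S x) - ‖L (qt x)‖ ^ 2| ≤ δ * b * ‖x‖ ^ 2) (x : E) :
    a / 2 * ‖x‖ ^ 2 ≤ ‖L x‖ ^ 2 ∧ ‖L x‖ ^ 2 ≤ 2 * b * ‖x‖ ^ 2 := by
  have hinj : Function.Injective (qt ∘ₗ q) := by
    rw [← LinearMap.ker_eq_bot, LinearMap.ker_eq_bot']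
    intro z hz
    have h1 := hF z
    rw [LinearMap.comp_apply] at hz
    rw [hz, zero_sub, norm_neg] at h1
    have h2 := norm_nonneg z
    have h3 : ‖z‖ = 0 := by nlinarith
    exact norm_eq_zero.1 h3
  obtain ⟨z, rfl⟩ := LinearMap.surjective_of_injective hinj x
  rw [LinearMap.comp_apply]
  have h1 := hF z
  have hz := norm_nonneg z
  have h2 : ‖qt (q z)‖ ≤ 11 / 10 * ‖z‖ := by
    have := norm_sub_norm_le (qt (q z)) z
    nlinarith
  have h3 : 9 / 10 * ‖z‖ ≤ ‖qt (q z)‖ := by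
    have := norm_sub_norm_le z (qt (q z))
    rw [norm_sub_rev] at this
    nlinarith
  have h2' := pow_le_pow_left₀ (norm_nonneg _) h2 2
  have h3' := pow_le_pow_left₀ (by positivity) h3 2
  have h4 := abs_le.1 (abs_norm_sq_sub_le_of_near_isometry hadj hF z)
  have h5 := abs_le.1 (herr (q z))
  have h6 := hlo (q z)
  have h7 := hhi (q z)
  set X := ‖qt (q z)‖
  set Y := ‖q z‖ ^ 2
  have hZ : 0 ≤ ‖z‖ ^ 2 := sq_nonneg _
  set Z := ‖z‖ ^ 2
  rw [mul_pow] at h2' h3'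
  have hY : 0 ≤ Y := sq_nonneg _
  have h8 : Y ≤ 11 / 10 * Z := by nlinarith
  have h9 : 9 / 10 * Z ≤ Y := by nlinarith
  have h10 : δ * b * Y ≤ a / 10 * Y := mul_le_mul_of_nonneg_right hδb hY
  constructor
  · have h11 : 9 / 10 * a * Y ≤ ‖L (qt (q z))‖ ^ 2 := by linarith
    have h12 : X ^ 2 ≤ 9 / 5 * Y := by nlinarith
    nlinarith
  · have h11 : ‖L (qt (q z))‖ ^ 2 ≤ 11 / 10 * b * Y := by nlinarith
    have h12 : Y ≤ 3 / 2 * X ^ 2 := by nlinarith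
    have h13 : 0 ≤ X ^ 2 := sq_nonneg _
    nlinarith [mul_le_mul_of_nonneg_left h12 (ha.le.trans hab)]

/-- This turns "`S` is close to `Q Λ Qᵀ`" into "`Qᵀ S Q` is close to `Λ`", with a relative error. At
`q x` the oracle compares `S` with `L (x + f)`, where `‖f‖ ≤ δ ‖x‖`, and expanding the square leaves
terms of order `δ b ‖x‖²`. -/
lemma approx_diag_form_error {κ : ℝ}
    (hadj : ∀ x y, inner ℝ (q x) y = inner ℝ x (qt y))
    (hδ0 : 0 ≤ δ) (hδ : δ ≤ 1 / 10) (hb : 0 < b) (hκ : b ≤ κ * a)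
    (hF : ∀ x, ‖qt (q x) - x‖ ≤ δ * ‖x‖)
    (herr : ∀ x, |inner ℝ x (S x) - ‖L (qt x)‖ ^ 2| ≤ δ * b * ‖x‖ ^ 2)
    (hκ0 : 0 ≤ κ)
    (hL : ∀ x, a / 2 * ‖x‖ ^ 2 ≤ ‖L x‖ ^ 2 ∧ ‖L x‖ ^ 2 ≤ 2 * b * ‖x‖ ^ 2) (x : E) :
    |inner ℝ (q x) (S (q x)) - ‖L x‖ ^ 2| ≤ 11 * δ * κ * ‖L x‖ ^ 2 := by
  set f := qt (q x) - x with hf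
  have h1 := hF x
  have hx := norm_nonneg x
  have h1' : ‖f‖ ^ 2 ≤ δ ^ 2 * ‖x‖ ^ 2 := by
    have := pow_le_pow_left₀ (norm_nonneg _) h1 2
    rwa [mul_pow] at this
  have h2 : L (qt (q x)) = L x + L f := by rw [← map_add, hf]; simp
  have h3 := herr (q x)
  rw [h2, norm_add_sq_real] at h3
  have h4 := abs_norm_sq_sub_le_of_near_isometry hadj hF x
  have h5 : ‖L f‖ ^ 2 ≤ 2 * b * (δ ^ 2 * ‖x‖ ^ 2) :=
    (hL f).2.trans (mul_le_mul_of_nonneg_left h1' (by positivity))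
  have h6 : ‖L x‖ * ‖L f‖ ≤ 2 * b * δ * ‖x‖ ^ 2 := by
    refine le_of_sq_le_sq ?_ (by positivity)
    rw [mul_pow]
    calc ‖L x‖ ^ 2 * ‖L f‖ ^ 2 ≤ (2 * b * ‖x‖ ^ 2) * (2 * b * (δ ^ 2 * ‖x‖ ^ 2)) :=
          mul_le_mul (hL x).2 h5 (sq_nonneg _) (by positivity)
      _ = _ := by ring
  have h7 := abs_le.1 ((abs_real_inner_le_norm (L x) (L f)).trans h6)
  have h8 := abs_le.1 h3
  have h9 := (abs_le.1 h4).2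
  have hX : 0 ≤ ‖x‖ ^ 2 := sq_nonneg _
  have h10 : δ * b * ‖q x‖ ^ 2 ≤ δ * b * (11 / 10 * ‖x‖ ^ 2) :=
    mul_le_mul_of_nonneg_left (by nlinarith) (by positivity)
  have h11 : 2 * b * (δ ^ 2 * ‖x‖ ^ 2) ≤ b * δ * (1 / 5 * ‖x‖ ^ 2) := by
    have : 0 ≤ b * δ * ‖x‖ ^ 2 := by positivity
    nlinarith
  have h0 : 0 ≤ ‖L f‖ ^ 2 := sq_nonneg _
  -- The cross term contributes `4`, the square of `L f` at most `1/5`, and `herr` at most `11/10`.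
  -- Passing from `b` to `κ a` and from `a / 2 * ‖x‖²` to `‖L x‖²` below doubles `11/2`.
  have h12 : |inner ℝ (q x) (S (q x)) - ‖L x‖ ^ 2| ≤ 11 / 2 * (δ * b * ‖x‖ ^ 2) := by
    have : 0 ≤ b * δ * ‖x‖ ^ 2 := by positivity
    exact abs_le.2 ⟨by linarith, by linarith⟩
  refine h12.trans ?_
  have h13 : δ * b * ‖x‖ ^ 2 ≤ δ * (κ * a) * ‖x‖ ^ 2 := by gcongr
  have h14 : δ * κ * (a / 2 * ‖x‖ ^ 2) ≤ δ * κ * ‖L x‖ ^ 2 :=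
    mul_le_mul_of_nonneg_left (hL x).1 (by positivity)
  nlinarith

end QuadraticForms

/-! ### The oracle's guarantee in terms of quadratic forms. -/

section Matrices

open Matrix

variable {n : ℕ}

lemma isSymmetric_toEuclideanCLM {A : Matrix (Fin n) (Fin n) ℝ} (hA : A.IsHermitian) :
    ((toEuclideanCLM (𝕜 := ℝ) A : EuclideanSpace ℝ (Fin n) →L[ℝ] EuclideanSpace ℝ (Fin n)) :
      EuclideanSpace ℝ (Fin n) →ₗ[ℝ] EuclideanSpace ℝ (Fin n)).IsSymmetric := by
  intro x y
  have h : Aᵀ = A := by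
    rw [← conjTranspose_eq_transpose_of_trivial]; exact hA
  have := inner_toEuclideanCLM_left A x y
  rwa [h] at this

lemma toEuclideanCLM_eigenvectorBasis {A : Matrix (Fin n) (Fin n) ℝ} (hA : A.IsHermitian)
    (i : Fin n) : toEuclideanCLM (𝕜 := ℝ) A (hA.eigenvectorBasis i) =
      hA.eigenvalues i • hA.eigenvectorBasis i := by
  apply (WithLp.ofLp_injective 2)
  rw [ofLp_toEuclideanCLM, hA.mulVec_eigenvectorBasis]
  rfl

/-- A bound on a positive semidefinite quadratic form bounds the spectral norm. -/
lemma specNorm_le_of_form_le {A : Matrix (Fin n) (Fin n) ℝ} (hA : A.PosSemidef) {b : ℝ}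
    (hb : 0 ≤ b) (h : ∀ x : EuclideanSpace ℝ (Fin n),
      inner ℝ x (toEuclideanCLM (𝕜 := ℝ) A x) ≤ b * ‖x‖ ^ 2) : specNorm A ≤ b := by
  refine ContinuousLinearMap.opNorm_le_bound _ hb fun x => ?_
  refine norm_apply_le_of_eigenbasis hA.1.eigenvectorBasis (isSymmetric_toEuclideanCLM hA.1)
    (toEuclideanCLM_eigenvectorBasis hA.1) hb (fun i => ?_) x
  rw [abs_of_nonneg (hA.eigenvalues_nonneg i)]
  have h1 := h (hA.1.eigenvectorBasis i)
  rw [toEuclideanCLM_eigenvectorBasis, real_inner_smul_right, real_inner_self_eq_norm_sq,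
    hA.1.eigenvectorBasis.orthonormal.1 i] at h1
  simpa using h1

/-- The extreme eigenvalues of a positive definite matrix. -/
lemma exists_form_bounds_of_condNumber_le {A : Matrix (Fin n) (Fin n) ℝ} (hA : A.PosDef)
    (hn : 0 < n) {κ : ℝ} (hκ : condNumber A ≤ κ) :
    ∃ a b : ℝ, 0 < a ∧ a ≤ b ∧ b ≤ κ * a ∧
      (∀ x : EuclideanSpace ℝ (Fin n), a * ‖x‖ ^ 2 ≤ inner ℝ x (toEuclideanCLM (𝕜 := ℝ) A x)) ∧
      (∀ x : EuclideanSpace ℝ (Fin n), inner ℝ x (toEuclideanCLM (𝕜 := ℝ) A x) ≤ b * ‖x‖ ^ 2) := by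
  -- In positive dimension the spectrum is nonempty and finite, so its infimum is an eigenvalue and
  -- hence positive.
  have : Nonempty (Fin n) := ⟨⟨0, hn⟩⟩
  have hspec := hA.1.spectrum_real_eq_range_eigenvalues
  have hfin : (spectrum ℝ A).Finite := by rw [hspec]; exact Set.finite_range _
  have hne : (spectrum ℝ A).Nonempty := by rw [hspec]; exact Set.range_nonempty _
  have hlo : ∀ i, sInf (spectrum ℝ A) ≤ hA.1.eigenvalues i := fun i =>
    csInf_le hfin.bddBelow (by rw [hspec]; exact Set.mem_range_self i)
  have hhi : ∀ i, hA.1.eigenvalues i ≤ sSup (spectrum ℝ A) := fun i =>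
    le_csSup hfin.bddAbove (by rw [hspec]; exact Set.mem_range_self i)
  have hpos : 0 < sInf (spectrum ℝ A) := by
    have h1 := hne.csInf_mem hfin
    rw [hspec] at h1
    obtain ⟨i, hi⟩ := h1
    rw [hspec, ← hi]
    exact hA.eigenvalues_pos i
  refine ⟨sInf (spectrum ℝ A), sSup (spectrum ℝ A), hpos,
    (hlo (Classical.arbitrary _)).trans (hhi _), ?_,
    le_inner_of_eigenbasis hA.1.eigenvectorBasis (isSymmetric_toEuclideanCLM hA.1)
      (toEuclideanCLM_eigenvectorBasis hA.1) hlo,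
    inner_le_of_eigenbasis hA.1.eigenvectorBasis (isSymmetric_toEuclideanCLM hA.1)
      (toEuclideanCLM_eigenvectorBasis hA.1) hhi⟩
  rwa [condNumber, div_le_iff₀ hpos] at hκ

/-- A matrix with singular values close to `1` is nearly orthogonal. -/
lemma norm_transpose_mul_self_sub_le {Q : Matrix (Fin n) (Fin n) ℝ} {δ : ℝ} (hδ0 : 0 ≤ δ)
    (hδ : δ ≤ 1) (h : ∀ i < n, (Matrix.toEuclideanLin Q).singularValues i ∈
      Set.Icc (1 - δ / 3) (1 + δ / 3)) (x : EuclideanSpace ℝ (Fin n)) :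
    ‖toEuclideanCLM (𝕜 := ℝ) Qᵀ (toEuclideanCLM (𝕜 := ℝ) Q x) - x‖ ≤ δ * ‖x‖ := by
  set T := Matrix.toEuclideanLin Q
  have hn : Module.finrank ℝ (EuclideanSpace ℝ (Fin n)) = n := by simp
  have hpos := T.isPositive_adjoint_comp_self
  set v := hpos.isSymmetric.eigenvectorBasis hn
  set T' : EuclideanSpace ℝ (Fin n) →ₗ[ℝ] EuclideanSpace ℝ (Fin n) :=
    T.adjoint ∘ₗ T - LinearMap.id with hT'
  have hsymm : T'.IsSymmetric := by
    intro x y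
    have := hpos.isSymmetric x y
    simp only [hT', LinearMap.sub_apply, LinearMap.id_apply, inner_sub_left, inner_sub_right, this]
  have hv : ∀ i, T' (v i) = (T.singularValues i ^ 2 - 1) • v i := by
    intro i
    rw [hT', LinearMap.sub_apply, LinearMap.id_apply, sub_smul, one_smul,
      T.sq_singularValues_fin hn i]
    congr 1
    exact hpos.isSymmetric.apply_eigenvectorBasis hn i
  -- For a singular value `σ`, `|σ² - 1| ≤ 2δ/3 + δ²/9 ≤ δ` because `δ ≤ 1`.
  have key := norm_apply_le_of_eigenbasis v hsymm hv hδ0 (fun i => by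
    have := h i i.2
    obtain ⟨h1, h2⟩ := this
    exact abs_le.2 ⟨by nlinarith, by nlinarith⟩) x
  have e : T' x = toEuclideanCLM (𝕜 := ℝ) Qᵀ (toEuclideanCLM (𝕜 := ℝ) Q x) - x := by
    rw [hT', LinearMap.sub_apply, LinearMap.id_apply, LinearMap.comp_apply,
      ← Matrix.toEuclideanLin_conjTranspose_eq_adjoint, conjTranspose_eq_transpose_of_trivial]
    rfl
  rwa [e] at key

lemma norm_diagonal_sq (l : Fin n → ℝ) (y : EuclideanSpace ℝ (Fin n)) :
    inner ℝ y (toEuclideanCLM (𝕜 := ℝ) (diagonal fun i => l i ^ 2) y) =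
      ‖toEuclideanCLM (𝕜 := ℝ) (diagonal l) y‖ ^ 2 := by
  rw [← real_inner_self_eq_norm_sq, inner_toEuclideanCLM_left, diagonal_transpose]
  have : (diagonal fun i => l i ^ 2) = diagonal l * diagonal l := by
    simp only [diagonal_mul_diagonal, sq]
  rw [this, map_mul]
  rfl

lemma toReal_mul (A B : Matrix (Fin n) (Fin n) ℚ) : toReal (A * B) = toReal A * toReal B := by
  ext i j
  simp [toReal, Matrix.mul_apply]

lemma toReal_transpose (A : Matrix (Fin n) (Fin n) ℚ) : toReal Aᵀ = (toReal A)ᵀ := rfl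

lemma toReal_diagonal (l : Fin n → ℚ) :
    toReal (diagonal l) = diagonal fun i => (l i : ℝ) := by
  simp [toReal, Matrix.diagonal_map]

lemma toReal_one : toReal (1 : Matrix (Fin n) (Fin n) ℚ) = 1 := by
  simp [toReal]

/-- What an approximate diagonalization says about quadratic forms. -/
lemma IsApproxDiag.form {A Q : Matrix (Fin n) (Fin n) ℚ} {l : Fin n → ℚ} {δ : ℚ}
    (h : IsApproxDiag A δ l Q) (hA : (toReal A).PosDef) {a b κ : ℝ} (hδ0 : 0 < δ) (ha : 0 < a)
    (hab : a ≤ b) (hκ : b ≤ κ * a) (hδκ : δ * κ ≤ 1 / 10)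
    (hlo : ∀ x : EuclideanSpace ℝ (Fin n),
      a * ‖x‖ ^ 2 ≤ inner ℝ x (toEuclideanCLM (𝕜 := ℝ) (toReal A) x))
    (hhi : ∀ x : EuclideanSpace ℝ (Fin n),
      inner ℝ x (toEuclideanCLM (𝕜 := ℝ) (toReal A) x) ≤ b * ‖x‖ ^ 2) :
    (∀ x, |‖toEuclideanCLM (𝕜 := ℝ) (toReal Q) x‖ ^ 2 - ‖x‖ ^ 2| ≤ δ * ‖x‖ ^ 2) ∧
    (∀ x, a / 2 * ‖x‖ ^ 2 ≤ ‖toEuclideanCLM (𝕜 := ℝ) (toReal (diagonal l)) x‖ ^ 2 ∧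
      ‖toEuclideanCLM (𝕜 := ℝ) (toReal (diagonal l)) x‖ ^ 2 ≤ 2 * b * ‖x‖ ^ 2) ∧
    (∀ x, |inner ℝ (toEuclideanCLM (𝕜 := ℝ) (toReal Q) x)
        (toEuclideanCLM (𝕜 := ℝ) (toReal A) (toEuclideanCLM (𝕜 := ℝ) (toReal Q) x)) -
        ‖toEuclideanCLM (𝕜 := ℝ) (toReal (diagonal l)) x‖ ^ 2| ≤
      11 * δ * κ * ‖toEuclideanCLM (𝕜 := ℝ) (toReal (diagonal l)) x‖ ^ 2) ∧
    ∀ i, 0 < l i := by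
  have hδ0' : (0 : ℝ) < δ := by exact_mod_cast hδ0
  have hκ1 : 1 ≤ κ := by
    by_contra! hc
    nlinarith
  have hδ : (δ : ℝ) ≤ 1 / 10 := by nlinarith
  have hδb : (δ : ℝ) * b ≤ a / 10 := by
    calc (δ : ℝ) * b ≤ δ * (κ * a) := by gcongr
      _ = δ * κ * a := by ring
      _ ≤ 1 / 10 * a := by gcongr
      _ = a / 10 := by ring
  set q : EuclideanSpace ℝ (Fin n) →ₗ[ℝ] EuclideanSpace ℝ (Fin n) :=
    ContinuousLinearMap.toLinearMap (toEuclideanCLM (𝕜 := ℝ) (toReal Q)) with hq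
  set qt : EuclideanSpace ℝ (Fin n) →ₗ[ℝ] EuclideanSpace ℝ (Fin n) :=
    ContinuousLinearMap.toLinearMap (toEuclideanCLM (𝕜 := ℝ) (toReal Q)ᵀ) with hqt
  set S : EuclideanSpace ℝ (Fin n) →ₗ[ℝ] EuclideanSpace ℝ (Fin n) :=
    ContinuousLinearMap.toLinearMap (toEuclideanCLM (𝕜 := ℝ) (toReal A)) with hS
  set L : EuclideanSpace ℝ (Fin n) →ₗ[ℝ] EuclideanSpace ℝ (Fin n) :=
    ContinuousLinearMap.toLinearMap (toEuclideanCLM (𝕜 := ℝ) (toReal (diagonal l))) with hL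
  have hadj : ∀ x y, inner ℝ (q x) y = inner ℝ x (qt y) := inner_toEuclideanCLM_left (toReal Q)
  have hF : ∀ x, ‖qt (q x) - x‖ ≤ δ * ‖x‖ :=
    norm_transpose_mul_self_sub_le hδ0'.le (by linarith) h.singular
  have herr : ∀ x, |inner ℝ x (S x) - ‖L (qt x)‖ ^ 2| ≤ δ * b * ‖x‖ ^ 2 := by
    intro x
    have e : toReal (A - Q * diagonal (fun i => l i ^ 2) * Q.transpose) =
        toReal A - toReal Q * (diagonal fun i => (l i : ℝ) ^ 2) * (toReal Q)ᵀ := by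
      have h1 : toReal (A - Q * diagonal (fun i => l i ^ 2) * Q.transpose) =
        toReal A - toReal (Q * diagonal (fun i => l i ^ 2) * Q.transpose) := by
        ext i j; simp [toReal]
      rw [h1, toReal_mul, toReal_mul, toReal_diagonal, toReal_transpose]
      simp
    have h1 := h.error
    rw [e] at h1
    have h2 : specNorm (toReal A) ≤ b :=
      specNorm_le_of_form_le hA.posSemidef (ha.le.trans hab) hhi
    have h3 := h1.trans (mul_le_mul_of_nonneg_left h2 hδ0'.le)
    have h4 : inner ℝ x (S x) - ‖L (qt x)‖ ^ 2 = inner ℝ x (toEuclideanCLM (𝕜 := ℝ)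
        (toReal A - toReal Q * (diagonal fun i => (l i : ℝ) ^ 2) * (toReal Q)ᵀ) x) := by
      have h5 : ‖L (qt x)‖ ^ 2 = inner ℝ (qt x) (toEuclideanCLM (𝕜 := ℝ)
          (diagonal fun i => (l i : ℝ) ^ 2) (qt x)) := by
        rw [norm_diagonal_sq, hL, toReal_diagonal]
        rfl
      have h6 : ∀ w, inner ℝ (qt x) w = inner ℝ x (q w) := fun w => by
        rw [real_inner_comm, ← hadj, real_inner_comm]
      rw [map_sub, h5, h6, map_mul, map_mul, _root_.sub_apply, inner_sub_right]
      rfl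
    rw [h4]
    refine (abs_real_inner_le_norm _ _).trans ?_
    calc ‖x‖ * ‖toEuclideanCLM (𝕜 := ℝ) (toReal A - toReal Q *
          (diagonal fun i => (l i : ℝ) ^ 2) * (toReal Q)ᵀ) x‖
        ≤ ‖x‖ * (δ * b * ‖x‖) :=
          mul_le_mul_of_nonneg_left (ContinuousLinearMap.le_of_opNorm_le _ h3 x) (norm_nonneg _)
      _ = _ := by ring
  have hLb : ∀ x, a / 2 * ‖x‖ ^ 2 ≤ ‖L x‖ ^ 2 ∧ ‖L x‖ ^ 2 ≤ 2 * b * ‖x‖ ^ 2 :=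
    approx_diag_form_bounds hadj hδ ha hδb hab hF hlo hhi herr
  refine ⟨abs_norm_sq_sub_le_of_near_isometry hadj hF, hLb,
    approx_diag_form_error hadj hδ0'.le hδ (ha.trans_le hab) hκ hF herr (by linarith) hLb, ?_⟩
  intro i
  -- A vanishing entry would make `L` kill a basis vector, against the lower bound `a / 2`.
  refine lt_of_le_of_ne (h.nonneg i) fun hi => ?_
  have h1 := (hLb (EuclideanSpace.single i 1)).1
  have h2 : L (EuclideanSpace.single i 1) = 0 := by
    apply (WithLp.ofLp_injective 2)
    change (toReal (diagonal l)) *ᵥ (Pi.single i 1) = 0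
    rw [toReal_diagonal, diagonal_mulVec_single, ← hi]
    simp
  rw [h2] at h1
  simp at h1
  linarith

end Matrices

/-! ### Change of coordinates and accuracy of the reduction. -/

section Reduction

open Matrix

variable {n : ℕ}

/-- The change of coordinates after the first diagonalization `(l, Q)`, transposed. -/
def whitening (l : Fin n → ℚ) (Q : Matrix (Fin n) (Fin n) ℚ) : Matrix (Fin n) (Fin n) ℚ :=
  Q * diagonal fun i => (l i)⁻¹

lemma toEuclideanCLM_mul_apply (A B : Matrix (Fin n) (Fin n) ℝ) (x : EuclideanSpace ℝ (Fin n)) :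
    toEuclideanCLM (𝕜 := ℝ) (A * B) x =
      toEuclideanCLM (𝕜 := ℝ) A (toEuclideanCLM (𝕜 := ℝ) B x) := by
  rw [map_mul]; rfl

lemma inner_transpose_mul_mul (S T : Matrix (Fin n) (Fin n) ℝ) (x : EuclideanSpace ℝ (Fin n)) :
    inner ℝ x (toEuclideanCLM (𝕜 := ℝ) (Tᵀ * S * T) x) =
      inner ℝ (toEuclideanCLM (𝕜 := ℝ) T x)
        (toEuclideanCLM (𝕜 := ℝ) S (toEuclideanCLM (𝕜 := ℝ) T x)) := by
  rw [toEuclideanCLM_mul_apply, toEuclideanCLM_mul_apply, inner_toEuclideanCLM_left T]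

lemma isUnit_of_near_isometry {Q : Matrix (Fin n) (Fin n) ℝ} {δ : ℝ} (hδ : δ < 1)
    (h : ∀ x, |‖toEuclideanCLM (𝕜 := ℝ) Q x‖ ^ 2 - ‖x‖ ^ 2| ≤ δ * ‖x‖ ^ 2) : IsUnit Q := by
  rw [← mulVec_injective_iff_isUnit, ← coe_mulVecLin, ← LinearMap.ker_eq_bot,
    LinearMap.ker_eq_bot']
  intro z hz
  have h1 := h (WithLp.toLp 2 z)
  rw [toEuclideanCLM_toLp] at h1
  rw [mulVecLin_apply] at hz
  rw [hz] at h1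
  have h2 := (abs_le.1 h1).1
  simp only [WithLp.toLp_zero, norm_zero] at h2
  have h3 := sq_nonneg ‖WithLp.toLp 2 z‖
  have h4 : ‖WithLp.toLp 2 z‖ ^ 2 = 0 := by nlinarith
  have h5 : WithLp.toLp 2 z = 0 := norm_eq_zero.1 (pow_eq_zero_iff two_ne_zero |>.1 h4)
  simpa using h5

lemma transpose_eq_of_posDef {S : Matrix (Fin n) (Fin n) ℝ} (hS : S.PosDef) : Sᵀ = S := by
  rw [← conjTranspose_eq_transpose_of_trivial]; exact hS.1

lemma posDef_transpose_mul_mul {S T : Matrix (Fin n) (Fin n) ℝ} (hS : S.PosDef) (hT : IsUnit T) :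
    (Tᵀ * S * T).PosDef := by
  have := hS.conjTranspose_mul_mul_same (B := T) (mulVec_injective_iff_isUnit.2 hT)
  rwa [conjTranspose_eq_transpose_of_trivial] at this

section Whitening

variable {l : Fin n → ℚ} {Q : Matrix (Fin n) (Fin n) ℚ}

lemma toReal_diagonal_mul_inv (hl : ∀ i, 0 < l i) :
    toReal (diagonal l) * toReal (diagonal fun i => (l i)⁻¹) = 1 := by
  rw [← toReal_mul, diagonal_mul_diagonal, ← toReal_one, ← diagonal_one]
  congr 2
  ext i
  exact mul_inv_cancel₀ (hl i).ne'

lemma toReal_diagonal_apply_inv (hl : ∀ i, 0 < l i) (x : EuclideanSpace ℝ (Fin n)) :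
    toEuclideanCLM (𝕜 := ℝ) (toReal (diagonal l))
      (toEuclideanCLM (𝕜 := ℝ) (toReal (diagonal fun i => (l i)⁻¹)) x) = x := by
  rw [← toEuclideanCLM_mul_apply, toReal_diagonal_mul_inv hl, map_one]
  rfl

lemma isUnit_toReal_whitening (hl : ∀ i, 0 < l i) (hQ : IsUnit (toReal Q)) :
    IsUnit (toReal (whitening l Q)) := by
  rw [whitening, toReal_mul]
  exact hQ.mul ((isUnit_iff_isUnit_det _).2
    (isUnit_det_of_left_inverse (toReal_diagonal_mul_inv hl)))

/-- Bounds on the quadratic form of the second query. -/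
lemma whitening_form_bounds {S : Matrix (Fin n) (Fin n) ℝ} {a b a₁ b₁ : ℝ} {δ : ℚ}
    (hl : ∀ i, 0 < l i) (hδ : (δ : ℝ) ≤ 1 / 10) (ha : 0 < a) (hab : a ≤ b) (ha₁ : 0 < a₁)
    (hb₁ : 0 < b₁)
    (hQ : ∀ x, |‖toEuclideanCLM (𝕜 := ℝ) (toReal Q) x‖ ^ 2 - ‖x‖ ^ 2| ≤ δ * ‖x‖ ^ 2)
    (hL : ∀ x, a / 2 * ‖x‖ ^ 2 ≤ ‖toEuclideanCLM (𝕜 := ℝ) (toReal (diagonal l)) x‖ ^ 2 ∧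
      ‖toEuclideanCLM (𝕜 := ℝ) (toReal (diagonal l)) x‖ ^ 2 ≤ 2 * b * ‖x‖ ^ 2)
    (hlo : ∀ x : EuclideanSpace ℝ (Fin n), a₁ * ‖x‖ ^ 2 ≤ inner ℝ x (toEuclideanCLM (𝕜 := ℝ) S x))
    (hhi : ∀ x : EuclideanSpace ℝ (Fin n), inner ℝ x (toEuclideanCLM (𝕜 := ℝ) S x) ≤ b₁ * ‖x‖ ^ 2)
    (x : EuclideanSpace ℝ (Fin n)) :
    a₁ / (3 * b) * ‖x‖ ^ 2 ≤ inner ℝ x (toEuclideanCLM (𝕜 := ℝ)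
      ((toReal (whitening l Q))ᵀ * S * toReal (whitening l Q)) x) ∧
    inner ℝ x (toEuclideanCLM (𝕜 := ℝ)
      ((toReal (whitening l Q))ᵀ * S * toReal (whitening l Q)) x) ≤ 3 * b₁ / a * ‖x‖ ^ 2 := by
  have hb : 0 < b := ha.trans_le hab
  rw [inner_transpose_mul_mul, whitening, toReal_mul, toEuclideanCLM_mul_apply]
  set y := toEuclideanCLM (𝕜 := ℝ) (toReal (diagonal fun i => (l i)⁻¹)) x with hy
  have h1 := hL y
  rw [hy, toReal_diagonal_apply_inv hl, ← hy] at h1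
  have h2 := abs_le.1 (hQ y)
  have h3 := hlo (toEuclideanCLM (𝕜 := ℝ) (toReal Q) y)
  have h4 := hhi (toEuclideanCLM (𝕜 := ℝ) (toReal Q) y)
  have hY : 0 ≤ ‖y‖ ^ 2 := sq_nonneg _
  -- With `x = L y`, the form is evaluated at `Q y`. The factors are `2` from `hL` and `10/9` or
  -- `11/10` from `hQ`, rounded up to `3`.
  constructor
  · refine le_trans ?_ h3
    rw [div_mul_eq_mul_div, div_le_iff₀ (by positivity)]
    have h5 : ‖x‖ ^ 2 ≤ 3 * b * ‖toEuclideanCLM (𝕜 := ℝ) (toReal Q) y‖ ^ 2 := by nlinarith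
    nlinarith
  · refine h4.trans ?_
    rw [div_mul_eq_mul_div, le_div_iff₀ ha]
    have h5 : a * ‖toEuclideanCLM (𝕜 := ℝ) (toReal Q) y‖ ^ 2 ≤ 3 * ‖x‖ ^ 2 := by
      have h6 : ‖toEuclideanCLM (𝕜 := ℝ) (toReal Q) y‖ ^ 2 ≤ 11 / 10 * ‖y‖ ^ 2 := by nlinarith
      have h7 := mul_le_mul_of_nonneg_left h6 ha.le
      have h8 := sq_nonneg ‖x‖
      linarith
    nlinarith

end Whitening

lemma toLp_mulVec_toReal (T : Matrix (Fin n) (Fin n) ℚ) (v : Fin n → ℚ) :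
    (WithLp.toLp 2 fun i => ((T *ᵥ v) i : ℝ)) =
      toEuclideanCLM (𝕜 := ℝ) (toReal T) (WithLp.toLp 2 fun i => (v i : ℝ)) := by
  rw [toEuclideanCLM_toLp]
  congr 1
  ext i
  simp [toReal, mulVec, dotProduct]

instance isProbabilityMeasure_gaussian {n : ℕ} (μ : Fin n → ℚ) (S : Matrix (Fin n) (Fin n) ℚ) :
    IsProbabilityMeasure (gaussian μ S) := by
  unfold gaussian; infer_instance

/-- Total variation distance is invariant under invertible affine changes of coordinates. -/
lemma tvDist_gaussian_eq {μ₁ μ₂ : Fin n → ℚ} {S₁ S₂ : Matrix (Fin n) (Fin n) ℚ}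
    (h₁ : (toReal S₁).PosDef) (h₂ : (toReal S₂).PosDef) {T : Matrix (Fin n) (Fin n) ℚ}
    (hT : IsUnit (toReal T)) :
    tvDist (gaussian μ₁ S₁) (gaussian μ₂ S₂) =
      tvDist (gaussian (T *ᵥ (μ₁ - μ₂)) (T * S₁ * Tᵀ)) (gaussian 0 (T * S₂ * Tᵀ)) := by
  set R := toReal T
  set m₁ : EuclideanSpace ℝ (Fin n) := WithLp.toLp 2 fun i => (μ₁ i : ℝ) with hm₁
  set m₂ : EuclideanSpace ℝ (Fin n) := WithLp.toLp 2 fun i => (μ₂ i : ℝ) with hm₂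
  set f : EuclideanSpace ℝ (Fin n) → EuclideanSpace ℝ (Fin n) :=
    fun x => -toEuclideanCLM (𝕜 := ℝ) R m₂ + toEuclideanCLM (𝕜 := ℝ) R x with hf
  set g : EuclideanSpace ℝ (Fin n) → EuclideanSpace ℝ (Fin n) :=
    fun y => toEuclideanCLM (𝕜 := ℝ) R⁻¹ (y + toEuclideanCLM (𝕜 := ℝ) R m₂) with hg
  have hfm : Measurable f := by fun_prop
  have hgm : Measurable g := by fun_prop
  have hgf : Function.LeftInverse g f := by
    intro x
    have h1 : -toEuclideanCLM (𝕜 := ℝ) R m₂ + toEuclideanCLM (𝕜 := ℝ) R x +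
        toEuclideanCLM (𝕜 := ℝ) R m₂ = toEuclideanCLM (𝕜 := ℝ) R x := by abel
    simp only [hf, hg]
    rw [h1, ← toEuclideanCLM_mul_apply, nonsing_inv_mul _ ((isUnit_iff_isUnit_det _).1 hT),
      map_one]
    rfl
  rw [← tvDist_map_of_leftInverse _ _ hfm hgm hgf]
  have e₁ : (gaussian μ₁ S₁).map f = gaussian (T *ᵥ (μ₁ - μ₂)) (T * S₁ * Tᵀ) := by
    rw [gaussian, map_multivariateGaussian _ _ _ _ h₁.posSemidef, gaussian, toReal_mul, toReal_mul,
      toReal_transpose, toLp_mulVec_toReal]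
    congr 1
    rw [add_comm, ← sub_eq_add_neg, ← map_sub]
    congr 1
    ext i
    simp [m₂]
  have e₂ : (gaussian μ₂ S₂).map f = gaussian 0 (T * S₂ * Tᵀ) := by
    rw [gaussian, map_multivariateGaussian _ _ _ _ h₂.posSemidef, gaussian, toReal_mul, toReal_mul,
      toReal_transpose]
    congr 1
    rw [add_comm, ← sub_eq_add_neg, sub_self]
    ext i
    simp
  rw [e₁, e₂]

/-- The two approximate diagonalizations give a diagonal instance at nearly the same distance. -/
theorem reduction_accuracy (hn : 0 < n) {x : Input n} (hx : x.Admissible) {δ : ℚ} (hδ0 : 0 < δ)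
    (hδ : (δ : ℝ) * (9 * x.κ ^ 2) ≤ 1 / 100) {l : Fin n → ℚ} {Q : Matrix (Fin n) (Fin n) ℚ}
    (h : IsApproxDiag x.S₂ δ l Q) :
    (toReal ((whitening l Q)ᵀ * x.S₁ * whitening l Q)).PosDef ∧
    ∀ {l' : Fin n → ℚ} {Q' : Matrix (Fin n) (Fin n) ℚ},
      IsApproxDiag ((whitening l Q)ᵀ * x.S₁ * whitening l Q) δ l' Q' →
      (∀ i, 0 < l' i) ∧
      |x.D - tvDist (gaussian ((Q'ᵀ * (whitening l Q)ᵀ) *ᵥ (x.μ₁ - x.μ₂))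
        (diagonal fun i => l' i ^ 2)) (gaussian 0 1)| ≤ 400 * n * δ * x.κ ^ 2 := by
  have hδ0' : (0 : ℝ) < δ := by exact_mod_cast hδ0
  have hκ1 : (1 : ℝ) < x.κ := by exact_mod_cast hx.one_lt_κ
  have hκ2 : (x.κ : ℝ) ≤ x.κ ^ 2 := by nlinarith
  have hδκ : (δ : ℝ) * x.κ ≤ 1 / 10 := by nlinarith
  have hδ1 : (δ : ℝ) ≤ 1 / 10 := by nlinarith
  obtain ⟨a₁, b₁, ha₁, hab₁, hk₁, hlo₁, hhi₁⟩ :=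
    exists_form_bounds_of_condNumber_le hx.posDef₁ hn hx.cond₁
  obtain ⟨a₂, b₂, ha₂, hab₂, hk₂, hlo₂, hhi₂⟩ :=
    exists_form_bounds_of_condNumber_le hx.posDef₂ hn hx.cond₂
  obtain ⟨hQ, hL, hS₂, hl⟩ := h.form hx.posDef₂ hδ0 ha₂ hab₂ hk₂ hδκ hlo₂ hhi₂
  set B := whitening l Q with hB
  set A := Bᵀ * x.S₁ * B with hA
  have hAr : toReal A = (toReal B)ᵀ * toReal x.S₁ * toReal B := by
    rw [hA, toReal_mul, toReal_mul, toReal_transpose]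
  have hBu : IsUnit (toReal B) :=
    isUnit_toReal_whitening hl (isUnit_of_near_isometry (by linarith) hQ)
  have hApos : (toReal A).PosDef := by
    rw [hAr]; exact posDef_transpose_mul_mul hx.posDef₁ hBu
  refine ⟨hApos, ?_⟩
  intro l' Q' h'
  have hb₂ : 0 < b₂ := ha₂.trans_le hab₂
  have hb₁ : 0 < b₁ := ha₁.trans_le hab₁
  have hAf := whitening_form_bounds hl hδ1 ha₂ hab₂ ha₁ hb₁ hQ hL hlo₁ hhi₁
  rw [← hB, ← hAr] at hAf
  have hab' : a₁ / (3 * b₂) ≤ 3 * b₁ / a₂ := by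
    rw [div_le_div_iff₀ (by positivity) ha₂]
    nlinarith
  -- The ratio of the two bounds is `9 (b₁/a₁)(b₂/a₂)`, so `9 κ²` plays the role of `κ` for the
  -- second query.
  have hk' : 3 * b₁ / a₂ ≤ 9 * (x.κ : ℝ) ^ 2 * (a₁ / (3 * b₂)) := by
    rw [← mul_div_assoc, div_le_div_iff₀ ha₂ (by positivity)]
    have := mul_le_mul hk₁ hk₂ hb₂.le (by positivity)
    nlinarith
  obtain ⟨hQ', hL', hA', hl'⟩ := h'.form hApos hδ0 (by positivity) hab' hk' (by linarith)
    (fun x => (hAf x).1) (fun x => (hAf x).2)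
  refine ⟨hl', ?_⟩
  set T := Q'ᵀ * Bᵀ with hT
  have hTr : toReal T = (toReal Q')ᵀ * (toReal B)ᵀ := by
    rw [hT, toReal_mul, toReal_transpose, toReal_transpose]
  have hTu : IsUnit (toReal T) := by
    rw [hTr]
    exact ((isUnit_transpose _).2 (isUnit_of_near_isometry (by linarith) hQ')).mul
      ((isUnit_transpose _).2 hBu)
  have hTt : (toReal T)ᵀ = toReal B * toReal Q' := by
    rw [hTr, transpose_mul, transpose_transpose, transpose_transpose]
  have hps : ∀ S : Matrix (Fin n) (Fin n) ℚ, (toReal S).PosDef →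
      (toReal (T * S * Tᵀ)).PosSemidef := by
    intro S hS
    rw [toReal_mul, toReal_mul, toReal_transpose]
    have := posDef_transpose_mul_mul hS ((isUnit_transpose _).2 hTu)
    rw [transpose_transpose] at this
    exact this.posSemidef
  have hform : ∀ (S : Matrix (Fin n) (Fin n) ℚ) (y : EuclideanSpace ℝ (Fin n)),
      inner ℝ y (toEuclideanCLM (𝕜 := ℝ) (toReal (T * S * Tᵀ)) y) =
        inner ℝ (toEuclideanCLM (𝕜 := ℝ) (toReal B) (toEuclideanCLM (𝕜 := ℝ) (toReal Q') y))
          (toEuclideanCLM (𝕜 := ℝ) (toReal S)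
            (toEuclideanCLM (𝕜 := ℝ) (toReal B) (toEuclideanCLM (𝕜 := ℝ) (toReal Q') y))) := by
    intro S y
    have h1 := inner_transpose_mul_mul (toReal S) (toReal T)ᵀ y
    rw [transpose_transpose, hTt, toEuclideanCLM_mul_apply (toReal B)] at h1
    rw [toReal_mul, toReal_mul, toReal_transpose, hTt, h1]
  rw [Input.D, tvDist_gaussian_eq hx.posDef₁ hx.posDef₂ hTu]
  refine (abs_tvDist_sub_le _ _ _ _).trans ?_
  have b1 : tvDist (gaussian (T *ᵥ (x.μ₁ - x.μ₂)) (T * x.S₁ * Tᵀ))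
      (gaussian (T *ᵥ (x.μ₁ - x.μ₂)) (diagonal fun i => l' i ^ 2)) ≤
      3 * n * (11 * δ * (9 * x.κ ^ 2)) := by
    have e : toReal (diagonal fun i => l' i ^ 2) = diagonal fun i => (l' i : ℝ) ^ 2 := by
      rw [toReal_diagonal]; push_cast; rfl
    rw [gaussian, gaussian, e]
    refine tvDist_near_diagonal _ (hps _ hx.posDef₁) (fun i => by exact_mod_cast hl' i)
      (by positivity) ?_ fun y => ?_
    · linarith
    · have h1 := hA' y
      rw [toReal_diagonal] at h1
      rw [hform]
      rwa [← inner_transpose_mul_mul (toReal x.S₁), ← hAr]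
  have b2 : tvDist (gaussian 0 (T * x.S₂ * Tᵀ)) (gaussian 0 1) ≤
      3 * n * (14 * δ * x.κ ^ 2) := by
    have e : (WithLp.toLp 2 fun i => (((0 : Fin n → ℚ) i : ℚ) : ℝ)) =
        (0 : EuclideanSpace ℝ (Fin n)) := by ext i; simp
    rw [gaussian, gaussian, toReal_one, e]
    have key : ∀ y : EuclideanSpace ℝ (Fin n),
        |inner ℝ y (toEuclideanCLM (𝕜 := ℝ) (toReal (T * x.S₂ * Tᵀ)) y) - ‖y‖ ^ 2| ≤
          14 * δ * x.κ ^ 2 * ‖y‖ ^ 2 := by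
      intro y
      rw [hform]
      have h1 := hS₂ (toEuclideanCLM (𝕜 := ℝ) (toReal (diagonal fun i => (l i)⁻¹))
        (toEuclideanCLM (𝕜 := ℝ) (toReal Q') y))
      rw [← toEuclideanCLM_mul_apply (toReal Q), ← toReal_mul, ← whitening, ← hB,
        toReal_diagonal_apply_inv hl] at h1
      have h2 := abs_le.1 h1
      have h3 := abs_le.1 (hQ' y)
      have hY : 0 ≤ ‖y‖ ^ 2 := sq_nonneg _
      -- Whitening leaves `11 δ κ ‖Q' y‖²`, and replacing `‖Q' y‖²` by `‖y‖²` costs another `δ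
      -- ‖y‖²`: `11 · 11/10 + 1 ≤ 14`.
      have h4 : 11 * (δ : ℝ) * x.κ * ‖toEuclideanCLM (𝕜 := ℝ) (toReal Q') y‖ ^ 2 ≤
          11 * (δ * x.κ ^ 2) * (11 / 10 * ‖y‖ ^ 2) := by
        rw [mul_assoc 11]
        have h5 : (δ : ℝ) * x.κ ≤ δ * x.κ ^ 2 := mul_le_mul_of_nonneg_left hκ2 hδ0'.le
        have h6 : ‖toEuclideanCLM (𝕜 := ℝ) (toReal Q') y‖ ^ 2 ≤ 11 / 10 * ‖y‖ ^ 2 := by nlinarith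
        gcongr
      have h5 : (δ : ℝ) * ‖y‖ ^ 2 ≤ δ * x.κ ^ 2 * ‖y‖ ^ 2 := by
        have : (δ : ℝ) ≤ δ * x.κ ^ 2 := by nlinarith
        exact mul_le_mul_of_nonneg_right this hY
      have h6 : 0 ≤ (δ : ℝ) * x.κ ^ 2 * ‖y‖ ^ 2 := by positivity
      exact abs_le.2 ⟨by linarith, by linarith⟩
    refine tvDist_near_standard (hps _ hx.posDef₂) (η := 14 * δ * x.κ ^ 2) (by positivity)
      (by linarith) (fun y => ?_) fun y => ?_
    · have := (abs_le.1 (key y)).1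
      linarith
    · have := (abs_le.1 (key y)).2
      linarith
  -- The constants add up to `3 · 99 + 3 · 14 = 339`.
  refine (add_le_add b1 b2).trans ?_
  have : (0 : ℝ) ≤ n * δ * x.κ ^ 2 := by positivity
  linarith

end Reduction

/-! ### The program: correctness, cost and queries. -/

section Programs

open Matrix

variable (O : Oracle)

lemma run_loop_induction {I : ℕ → State → Prop} {v : ℕ} {bound : Idx} {body : Prog} {s : State}
    {m : ℕ} (hm : s.idx bound = m) (h0 : I 0 s.tick)
    (hs : ∀ i < m, ∀ t, I i t → I (i + 1) (body.run O (t.setReg v i).tick)) :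
    I m ((Prog.loop v bound body).run O s) := by
  have key : ∀ k ≤ m, I k ((List.range k).foldl
      (fun t i => body.run O (t.setReg v i).tick) s.tick) := by
    intro k
    induction k with
    | zero => intro _; exact h0
    | succ k ih =>
      intro hk
      rw [List.range_succ, List.foldl_append]
      exact hs k hk _ (ih (by omega))
  rw [Prog.run, hm]
  exact key m le_rfl

/-- From `s` to `t`, at most `K` steps were made, without oracle calls, and only the array `dst` and
the scratch array `16` were written. -/
structure Frame (s t : State) (dst K : ℕ) : Prop where
  reg_zero : t.reg 0 = s.reg 0
  queries : t.queries = s.queries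
  steps : t.steps ≤ s.steps + K
  mem : ∀ a, a ≠ dst → a ≠ 16 → t.mem a = s.mem a

lemma Frame.block {s t : State} {dst K : ℕ} (h : Frame s t dst K) {a : ℕ} (ha : a ≠ dst)
    (ha' : a ≠ 16) (m : ℕ) : t.block a m = s.block a m := by
  simp only [State.block, h.mem a ha ha']

/-- Run `body` for all pairs of indices below `n`, held in the registers `1` and `2`. -/
def forPairs (body : Prog) : Prog :=
  .loop 1 (.reg 0) (.loop 2 (.reg 0) body)

/-- The invariant follows the lexicographic order: entries before `(i, j)` with column below `n` are
final, those from `(i, j)` on are still original. The body may thus read the old value of its own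
entry, which permits in-place operations and accumulation. In the cost, `2` counts an outer
iteration and the entry into the inner loop. -/
lemma run_forPairs {body : Prog} {n K dst : ℕ} {s : State} {F : ℕ → ℕ → ℚ} (hn : s.reg 0 = n)
    (hbody : ∀ i < n, ∀ j < n, ∀ t : State, t.reg 0 = n → t.reg 1 = i → t.reg 2 = j →
      (∀ a, a ≠ dst → a ≠ 16 → t.mem a = s.mem a) → t.mem dst i j = s.mem dst i j →
      Frame t (body.run O t) dst K ∧ (body.run O t).reg 1 = i ∧
      (∀ p q, ¬ (p = i ∧ q = j) → (body.run O t).mem dst p q = t.mem dst p q) ∧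
      (body.run O t).mem dst i j = F i j) :
    Frame s ((forPairs body).run O s) dst (1 + n * (2 + n * (1 + K))) ∧
      ∀ i < n, ∀ j < n, ((forPairs body).run O s).mem dst i j = F i j := by
  let J : ℕ → ℕ → ℕ → State → Prop := fun k i j t =>
    Frame s t dst k ∧ (∀ p q, p < i ∨ (p = i ∧ q < j) → q < n → t.mem dst p q = F p q) ∧
      ∀ p q, i < p ∨ (p = i ∧ j ≤ q) → t.mem dst p q = s.mem dst p q
  have main : J (1 + n * (2 + n * (1 + K))) n 0 ((forPairs body).run O s) := by
    refine run_loop_induction O (I := fun i t => J (1 + i * (2 + n * (1 + K))) i 0 t)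
      (m := n) hn ?_ ?_
    · exact ⟨⟨rfl, rfl, by simp [State.tick], fun _ _ _ => rfl⟩, by simp, fun _ _ _ => rfl⟩
    · rintro i hi t ⟨hf, hdone, horig⟩
      have inner := run_loop_induction O (v := 2) (bound := .reg 0) (body := body)
        (s := (t.setReg 1 i).tick)
        (I := fun j u => J (1 + i * (2 + n * (1 + K)) + 2 + j * (1 + K)) i j u ∧ u.reg 1 = i)
        (m := n) (by simp [State.idx, State.tick, State.setReg, hf.reg_zero, hn]) ?_ ?_
      · obtain ⟨⟨hf', hdone', horig'⟩, -⟩ := inner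
        refine ⟨⟨hf'.reg_zero, hf'.queries, hf'.steps.trans (le_of_eq ?_), hf'.mem⟩, ?_, ?_⟩
        · ring
        · intro p q hpq hq
          exact hdone' p q (by omega) hq
        · intro p q hpq
          exact horig' p q (by omega)
      · refine ⟨⟨⟨?_, hf.queries, ?_, hf.mem⟩, hdone, horig⟩, ?_⟩
        · simp [State.tick, State.setReg, hf.reg_zero]
        · have := hf.steps
          simp only [State.tick, State.setReg]
          omega
        · simp [State.tick, State.setReg]
      · rintro j hj u ⟨⟨hf', hdone', horig'⟩, hr⟩
        set w := (u.setReg 2 j).tick with hw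
        have hwm : w.mem = u.mem := rfl
        obtain ⟨hb, hb1, hb2, hb3⟩ := hbody i hi j hj w
          (by simp [hw, State.tick, State.setReg, hf'.reg_zero, hn])
          (by simp [hw, State.tick, State.setReg, hr])
          (by simp [hw, State.tick, State.setReg]) hf'.mem (horig' i j (by omega))
        refine ⟨⟨⟨?_, hb.queries.trans hf'.queries, ?_, ?_⟩, ?_, ?_⟩, hb1⟩
        · rw [hb.reg_zero, ← hf'.reg_zero]
          simp [hw, State.tick, State.setReg]
        · have h1 := hb.steps
          have h2 := hf'.steps
          have h3 : w.steps = u.steps + 1 := rfl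
          rw [h3] at h1
          have h4 : (j + 1) * (1 + K) = j * (1 + K) + (1 + K) := by ring
          omega
        · intro a ha ha'
          rw [hb.mem a ha ha', hwm, hf'.mem a ha ha']
        · intro p q hpq hq
          by_cases h : p = i ∧ q = j
          · rw [h.1, h.2]; exact hb3
          · rw [hb2 p q h, hwm]
            exact hdone' p q (by omega) hq
        · intro p q hpq
          rw [hb2 p q (by omega), hwm]
          exact horig' p q (by omega)
  exact ⟨main.1, fun i hi j hj => main.2.1 i j (Or.inl hi) hj⟩

/-- Entrywise operation `dst[i][j] := a[i][j] op b[r][j]`, where `r` is the content of a register. -/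
def mapPairs (op : ArithOp) (dst a b r : ℕ) : Prog :=
  forPairs (.arith op ⟨dst, .reg 1, .reg 2⟩ ⟨a, .reg 1, .reg 2⟩ ⟨b, .reg r, .reg 2⟩)

/-- The choice `r = 1` is entrywise and may work in place. The choice `r = 2` reads the diagonal
entry `b[j][j]`, which scales columns by a diagonal matrix; there `b` must not be overwritten
meanwhile. -/
lemma run_mapPairs {op : ArithOp} {dst a b r n : ℕ} {s : State} (hn : s.reg 0 = n)
    (ha' : a ≠ 16) (hb' : b ≠ 16) (hr : r = 1 ∨ (r = 2 ∧ b ≠ dst)) :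
    Frame s ((mapPairs op dst a b r).run O s) dst (1 + n * (2 + n * (1 + 1))) ∧
      ∀ i < n, ∀ j < n, ((mapPairs op dst a b r).run O s).mem dst i j =
        op.eval (s.mem a i j) (s.mem b (if r = 1 then i else j) j) := by
  refine run_forPairs O hn ?_
  intro i hi j hj t h0 h1 h2 hm hd
  have hA : t.mem a i j = s.mem a i j := by
    by_cases h : a = dst
    · rw [h, hd]
    · rw [hm a h ha']
  have hB : t.mem b (t.reg r) j = s.mem b (if r = 1 then i else j) j := by
    rcases hr with rfl | ⟨rfl, hb⟩
    · by_cases h : b = dst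
      · simp [h, h1, hd]
      · simp [h1, hm b h hb']
    · simp [h2, hm b hb hb']
  refine ⟨⟨rfl, rfl, le_rfl, ?_⟩, h1, ?_, ?_⟩
  · intro c hc _
    funext p q
    simp [Prog.run, State.tick, State.set, hc]
  · intro p q hpq
    simp only [Prog.run, State.tick, State.set, State.idx, h1, h2]
    rw [if_neg (by tauto)]
  · simp only [Prog.run, State.tick, State.set, State.get, State.idx, h1, h2]
    simp [hA, hB]

/-- Add the product of the transpose of `a` with `b` to the array `dst`. -/
def addTransposeMul (dst a b : ℕ) : Prog :=
  forPairs (.loop 3 (.reg 0)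
    (.seq (.arith .mul ⟨16, .lit 0, .lit 0⟩ ⟨a, .reg 3, .reg 1⟩ ⟨b, .reg 3, .reg 2⟩)
      (.arith .add ⟨dst, .reg 1, .reg 2⟩ ⟨dst, .reg 1, .reg 2⟩ ⟨16, .lit 0, .lit 0⟩)))

/-- Products are accumulated onto `dst`, hence the hypothesis that it starts at zero; each product
in the reduction gets an untouched array. -/
lemma run_addTransposeMul {dst a b n : ℕ} {s : State} (hn : s.reg 0 = n)
    (ha : a ≠ dst) (hb : b ≠ dst) (hd : dst ≠ 16) (ha' : a ≠ 16) (hb' : b ≠ 16)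
    (hzero : ∀ i j, s.mem dst i j = 0) :
    Frame s ((addTransposeMul dst a b).run O s) dst (1 + n * (2 + n * (1 + (1 + 3 * n)))) ∧
      ((addTransposeMul dst a b).run O s).block dst n = (s.block a n)ᵀ * s.block b n := by
  have key := run_forPairs O (s := s) (dst := dst) (K := 1 + 3 * n)
    (F := fun i j => ∑ k ∈ Finset.range n, s.mem a k i * s.mem b k j) hn
    (body := .loop 3 (.reg 0)
      (.seq (.arith .mul ⟨16, .lit 0, .lit 0⟩ ⟨a, .reg 3, .reg 1⟩ ⟨b, .reg 3, .reg 2⟩)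
      (.arith .add ⟨dst, .reg 1, .reg 2⟩ ⟨dst, .reg 1, .reg 2⟩ ⟨16, .lit 0, .lit 0⟩))) ?_
  · refine ⟨key.1, ?_⟩
    ext i j
    have h := key.2 i i.2 j j.2
    rw [Matrix.mul_apply]
    refine h.trans ?_
    rw [Finset.sum_range]
    rfl
  · intro i hi j hj t h0 h1 h2 hm hdt
    have := run_loop_induction O (v := 3) (bound := .reg 0) (s := t) (m := n) h0
      (I := fun k u => Frame t u dst (1 + 3 * k) ∧ u.reg 1 = i ∧ u.reg 2 = j ∧
        (∀ p q, ¬ (p = i ∧ q = j) → u.mem dst p q = t.mem dst p q) ∧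
        u.mem dst i j = ∑ k ∈ Finset.range k, s.mem a k i * s.mem b k j)
      (body := .seq (.arith .mul ⟨16, .lit 0, .lit 0⟩ ⟨a, .reg 3, .reg 1⟩ ⟨b, .reg 3, .reg 2⟩)
        (.arith .add ⟨dst, .reg 1, .reg 2⟩ ⟨dst, .reg 1, .reg 2⟩ ⟨16, .lit 0, .lit 0⟩)) ?_ ?_
    · obtain ⟨c1, c2, c3, c4, c5⟩ := this
      exact ⟨c1, c2, c4, c5⟩
    · refine ⟨⟨rfl, rfl, le_rfl, fun _ _ _ => rfl⟩, h1, h2, fun _ _ _ => rfl, ?_⟩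
      simp [State.tick, hdt, hzero]
    · rintro k hk u ⟨c1, c2, c3, c4, c5⟩
      have hua : u.mem a = s.mem a := (c1.mem a ha ha').trans (hm a ha ha')
      have hub : u.mem b = s.mem b := (c1.mem b hb hb').trans (hm b hb hb')
      refine ⟨⟨?_, c1.queries, ?_, ?_⟩, ?_, ?_, ?_, ?_⟩
      · simp [Prog.run, State.tick, State.set, State.setReg, c1.reg_zero]
      · have := c1.steps
        simp only [Prog.run, State.tick, State.set, State.setReg]
        omega
      · intro c hc hc'
        rw [← c1.mem c hc hc']
        funext p q
        simp [Prog.run, State.tick, State.set, State.setReg, hc, hc']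
      · simp [Prog.run, State.tick, State.set, State.setReg, c2]
      · simp [Prog.run, State.tick, State.set, State.setReg, c3]
      · intro p q hpq
        rw [← c4 p q hpq]
        simp [Prog.run, State.tick, State.set, State.setReg, State.idx, c2, c3, hd]
        intro h3 h4
        exact absurd ⟨h3, h4⟩ hpq
      · simp [Prog.run, State.tick, State.set, State.setReg, State.get, State.idx, c2, c3, hd,
          c5, hua, hub, ArithOp.eval, Finset.sum_range_succ]

lemma run_diag {dim : Idx} {src dstL dstQ m : ℕ} {err : Cell} {s : State} (hm : s.idx dim = m)
    (hd : dstL ≠ dstQ) :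
    ((Prog.diag dim src err dstL dstQ).run O s).reg = s.reg ∧
    ((Prog.diag dim src err dstL dstQ).run O s).steps = s.steps + 1 ∧
    ((Prog.diag dim src err dstL dstQ).run O s).queries =
      s.queries ++ [⟨m, s.block src m, s.get err⟩] ∧
    (∀ a, a ≠ dstL → a ≠ dstQ →
      ((Prog.diag dim src err dstL dstQ).run O s).mem a = s.mem a) ∧
    ((Prog.diag dim src err dstL dstQ).run O s).block dstL m =
      diagonal (O s.queries.length m (s.block src m) (s.get err)).1 ∧
    ((Prog.diag dim src err dstL dstQ).run O s).block dstQ m =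
      (O s.queries.length m (s.block src m) (s.get err)).2 := by
  subst hm
  refine ⟨rfl, rfl, rfl, ?_, ?_, ?_⟩
  · intro a h1 h2
    funext i j
    simp [Prog.run, State.setBlock, State.tick, h1, h2]
  · ext i j
    simp [Prog.run, State.setBlock, State.tick, State.block, hd]
  · ext i j
    simp [Prog.run, State.setBlock, State.tick, State.block]

/-- Compute the error parameter of the oracle calls, in the cell `7[0][0]`. -/
def errorParameter (c : ℚ) : Prog :=
  .seq (.const ⟨7, .lit 0, .lit 1⟩ 1) <|
  .seq (.loop 1 (.reg 0)
    (.arith .add ⟨7, .lit 0, .lit 2⟩ ⟨7, .lit 0, .lit 2⟩ ⟨7, .lit 0, .lit 1⟩)) <|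
  .seq (.ifLe ⟨0, .lit 0, .lit 0⟩ ⟨7, .lit 0, .lit 1⟩
    (.arith .mul ⟨7, .lit 0, .lit 3⟩ ⟨0, .lit 0, .lit 0⟩ ⟨0, .lit 0, .lit 1⟩)
    (.arith .mul ⟨7, .lit 0, .lit 3⟩ ⟨7, .lit 0, .lit 1⟩ ⟨0, .lit 0, .lit 1⟩)) <|
  .seq (.arith .mul ⟨7, .lit 0, .lit 4⟩ ⟨7, .lit 0, .lit 2⟩ ⟨0, .lit 0, .lit 2⟩) <|
  .seq (.arith .div ⟨7, .lit 0, .lit 5⟩ ⟨7, .lit 0, .lit 3⟩ ⟨7, .lit 0, .lit 4⟩) <|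
  .seq (.arith .mul ⟨7, .lit 0, .lit 6⟩ ⟨7, .lit 0, .lit 5⟩ ⟨7, .lit 0, .lit 5⟩) <|
  .seq (.const ⟨7, .lit 0, .lit 7⟩ c) <|
  .arith .mul ⟨7, .lit 0, .lit 0⟩ ⟨7, .lit 0, .lit 7⟩ ⟨7, .lit 0, .lit 6⟩

/-- The dimension sits in an index register, out of reach of arithmetic, so it is rebuilt as a
rational by adding `1` in a loop; this accounts for the `2 * n` steps. -/
lemma run_errorParameter (c : ℚ) {n : ℕ} {s : State} (hn : s.reg 0 = n)
    (hzero : ∀ i j, s.mem 7 i j = 0) :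
    Frame s ((errorParameter c).run O s) 7 (2 * n + 9) ∧
      ((errorParameter c).run O s).mem 7 0 0 =
        c * (min (s.mem 0 0 0) 1 * s.mem 0 0 1 / (n * s.mem 0 0 2)) ^ 2 := by
  set s₁ := (Prog.const ⟨7, .lit 0, .lit 1⟩ 1).run O s with hs₁
  set s₂ := (Prog.loop 1 (.reg 0)
    (.arith .add ⟨7, .lit 0, .lit 2⟩ ⟨7, .lit 0, .lit 2⟩ ⟨7, .lit 0, .lit 1⟩)).run O s₁ with hs₂
  have h₁ : Frame s s₁ 7 1 ∧ s₁.mem 7 0 1 = 1 ∧ s₁.mem 7 0 2 = 0 := by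
    refine ⟨⟨rfl, rfl, le_rfl, fun a ha _ => ?_⟩, ?_, ?_⟩
    · funext i j
      simp [hs₁, Prog.run, State.tick, State.set, ha]
    · simp [hs₁, Prog.run, State.tick, State.set, State.idx]
    · simp [hs₁, Prog.run, State.tick, State.set, State.idx, hzero]
  have h₂ : Frame s s₂ 7 (2 + 2 * n) ∧ s₂.mem 7 0 1 = 1 ∧ s₂.mem 7 0 2 = n := by
    refine run_loop_induction O (m := n)
      (I := fun k t => Frame s t 7 (2 + 2 * k) ∧ t.mem 7 0 1 = 1 ∧ t.mem 7 0 2 = k) ?_ ?_ ?_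
    · exact h₁.1.reg_zero.trans hn
    · refine ⟨⟨h₁.1.reg_zero, h₁.1.queries, ?_, h₁.1.mem⟩, h₁.2.1, ?_⟩
      · have := h₁.1.steps
        simp only [State.tick]
        omega
      · simpa [State.tick] using h₁.2.2
    · rintro k hk t ⟨hf, h1, h2⟩
      refine ⟨⟨?_, hf.queries, ?_, fun a ha ha' => ?_⟩, ?_, ?_⟩
      · simp [Prog.run, State.tick, State.set, State.setReg, hf.reg_zero]
      · have := hf.steps
        simp only [Prog.run, State.tick, State.set, State.setReg]
        omega
      · rw [← hf.mem a ha ha']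
        funext i j
        simp [Prog.run, State.tick, State.set, State.setReg, ha]
      · simp [Prog.run, State.tick, State.set, State.setReg, State.idx, h1]
      · simp [Prog.run, State.tick, State.set, State.setReg, State.idx, State.get, h1, h2,
          ArithOp.eval]
  have hrun : (errorParameter c).run O s = Prog.run O (
      .seq (.ifLe ⟨0, .lit 0, .lit 0⟩ ⟨7, .lit 0, .lit 1⟩
        (.arith .mul ⟨7, .lit 0, .lit 3⟩ ⟨0, .lit 0, .lit 0⟩ ⟨0, .lit 0, .lit 1⟩)
        (.arith .mul ⟨7, .lit 0, .lit 3⟩ ⟨7, .lit 0, .lit 1⟩ ⟨0, .lit 0, .lit 1⟩)) <|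
      .seq (.arith .mul ⟨7, .lit 0, .lit 4⟩ ⟨7, .lit 0, .lit 2⟩ ⟨0, .lit 0, .lit 2⟩) <|
      .seq (.arith .div ⟨7, .lit 0, .lit 5⟩ ⟨7, .lit 0, .lit 3⟩ ⟨7, .lit 0, .lit 4⟩) <|
      .seq (.arith .mul ⟨7, .lit 0, .lit 6⟩ ⟨7, .lit 0, .lit 5⟩ ⟨7, .lit 0, .lit 5⟩) <|
      .seq (.const ⟨7, .lit 0, .lit 7⟩ c) <|
      .arith .mul ⟨7, .lit 0, .lit 0⟩ ⟨7, .lit 0, .lit 7⟩ ⟨7, .lit 0, .lit 6⟩) s₂ := rfl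
  obtain ⟨hf, h1, h2⟩ := h₂
  have h0 := hf.mem 0 (by norm_num) (by norm_num)
  rw [hrun]
  clear_value s₂
  have hg : ∀ k, s₂.get ⟨0, .lit 0, .lit k⟩ = s.mem 0 0 k := fun k => by
    rw [← h0]; rfl
  have hg7 : s₂.get ⟨7, .lit 0, .lit 1⟩ = 1 := h1
  have hst := hf.steps
  by_cases hc : s.mem 0 0 0 ≤ 1
  · refine ⟨⟨?_, ?_, ?_, fun a ha ha' => ?_⟩, ?_⟩
    · simp [Prog.run, State.tick, State.set, hg, hg7, hc, hf.reg_zero]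
    · simp [Prog.run, State.tick, State.set, hg, hg7, hc, hf.queries]
    · simp only [Prog.run, hg, hg7, hc, if_true, State.tick, State.set]
      omega
    · rw [← hf.mem a ha ha']
      funext i j
      simp [Prog.run, State.tick, State.set, hg, hg7, hc, ha]
    · simp [Prog.run, State.tick, State.set, State.get, State.idx, h1, h2, h0, hc, ArithOp.eval,
        sq]
  · refine ⟨⟨?_, ?_, ?_, fun a ha ha' => ?_⟩, ?_⟩
    · simp [Prog.run, State.tick, State.set, hg, hg7, hc, hf.reg_zero]
    · simp [Prog.run, State.tick, State.set, hg, hg7, hc, hf.queries]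
    · simp only [Prog.run, hg, hg7, hc, if_false, State.tick, State.set]
      omega
    · rw [← hf.mem a ha ha']
      funext i j
      simp [Prog.run, State.tick, State.set, hg, hg7, hc, ha]
    · simp [Prog.run, State.tick, State.set, State.get, State.idx, h1, h2, h0, hc, ArithOp.eval,
        sq, min_eq_right (not_le.1 hc).le]

/-- The whole reduction. -/
def reduction (c : ℚ) : Prog :=
  .seq (errorParameter c) <|
  .seq (.diag (.reg 0) 4 ⟨7, .lit 0, .lit 0⟩ 8 9) <|
  .seq (mapPairs .div 10 9 8 2) <|
  .seq (addTransposeMul 11 2 10) <|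
  .seq (addTransposeMul 12 10 11) <|
  .seq (.diag (.reg 0) 12 ⟨7, .lit 0, .lit 0⟩ 6 13) <|
  .seq (mapPairs .sub 14 1 3 1) <|
  .seq (addTransposeMul 15 10 14) <|
  .seq (addTransposeMul 5 13 15) <|
  mapPairs .mul 6 6 6 1

lemma step_bound {n a₁ a₂ a₃ a₄ a₅ a₆ a₇ a₈ a₉ a : ℕ} (hn : 0 < n)
    (h₁ : a₁ ≤ 0 + (2 * n + 9)) (h₂ : a₂ = a₁ + 1) (h₃ : a₃ ≤ a₂ + (1 + n * (2 + n * (1 + 1))))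
    (h₄ : a₄ ≤ a₃ + (1 + n * (2 + n * (1 + (1 + 3 * n)))))
    (h₅ : a₅ ≤ a₄ + (1 + n * (2 + n * (1 + (1 + 3 * n))))) (h₆ : a₆ = a₅ + 1)
    (h₇ : a₇ ≤ a₆ + (1 + n * (2 + n * (1 + 1))))
    (h₈ : a₈ ≤ a₇ + (1 + n * (2 + n * (1 + (1 + 3 * n)))))
    (h₉ : a₉ ≤ a₈ + (1 + n * (2 + n * (1 + (1 + 3 * n)))))
    (h : a ≤ a₉ + (1 + n * (2 + n * (1 + 1)))) : a ≤ 100 * n ^ 3 := by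
  have u1 : n ≤ n ^ 3 := Nat.le_self_pow (by norm_num) n
  have u2 : n * n ≤ n ^ 3 := by
    rw [← sq]; exact Nat.pow_le_pow_right hn (by norm_num)
  have u3 : 1 ≤ n ^ 3 := Nat.one_le_pow _ _ hn
  have e₁ : n * (2 + n * (1 + 1)) = 2 * n + 2 * (n * n) := by ring
  have e₂ : n * (2 + n * (1 + (1 + 3 * n))) = 2 * n + 2 * (n * n) + 3 * n ^ 3 := by ring
  rw [e₁] at h₃ h₇ h
  rw [e₂] at h₄ h₅ h₈ h₉
  omega

/-- Result, cost and oracle calls of the reduction. -/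
theorem run_reduction (c : ℚ) {n : ℕ} (hn : 0 < n) (x : Input n) :
    let s := (reduction c).run O x.init
    let δ : ℚ := c * (min x.ε 1 * x.Δ / (n * x.κ)) ^ 2
    let r₀ := O 0 n x.S₂ δ
    let A := (whitening r₀.1 r₀.2)ᵀ * x.S₁ᵀ * whitening r₀.1 r₀.2
    let r₁ := O 1 n A δ
    s.outMean n = (r₁.2ᵀ * (whitening r₀.1 r₀.2)ᵀ) *ᵥ (x.μ₁ - x.μ₂) ∧
    s.outCov n = diagonal (fun i => r₁.1 i ^ 2) ∧
    s.steps ≤ 100 * n ^ 3 ∧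
    s.queries = [⟨n, x.S₂, δ⟩, ⟨n, A, δ⟩] := by
  intro s δ r₀ A r₁
  set s₀ := x.init
  set s₁ := (errorParameter c).run O s₀ with hs₁
  set s₂ := (Prog.diag (.reg 0) 4 ⟨7, .lit 0, .lit 0⟩ 8 9).run O s₁ with hs₂
  set s₃ := (mapPairs .div 10 9 8 2).run O s₂ with hs₃
  set s₄ := (addTransposeMul 11 2 10).run O s₃ with hs₄
  set s₅ := (addTransposeMul 12 10 11).run O s₄ with hs₅
  set s₆ := (Prog.diag (.reg 0) 12 ⟨7, .lit 0, .lit 0⟩ 6 13).run O s₅ with hs₆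
  set s₇ := (mapPairs .sub 14 1 3 1).run O s₆ with hs₇
  set s₈ := (addTransposeMul 15 10 14).run O s₇ with hs₈
  set s₉ := (addTransposeMul 5 13 15).run O s₈ with hs₉
  have hs : s = (mapPairs .mul 6 6 6 1).run O s₉ := rfl
  clear_value s s₉ s₈ s₇ s₆ s₅ s₄ s₃ s₂ s₁
  -- the input
  have z : ∀ a, 4 < a → ∀ i j, s₀.mem a i j = 0 := by
    intro a ha i j
    simp only [s₀, Input.init]
    rw [if_neg (by omega), if_neg (by omega), if_neg (by omega), if_neg (by omega),
      if_neg (by omega)]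
  have i1 : s₀.block 2 n = x.S₁ := by
    ext i j; simp [s₀, State.block, Input.init]
  have i2 : s₀.block 4 n = x.S₂ := by
    ext i j; simp [s₀, State.block, Input.init]
  have n0 : s₀.reg 0 = n := rfl
  -- the error parameter
  obtain ⟨f1, d1⟩ := run_errorParameter O c n0 (z 7 (by norm_num))
  rw [← hs₁] at f1 d1
  replace d1 : s₁.mem 7 0 0 = δ := d1
  have n1 : s₁.reg 0 = n := f1.reg_zero.trans n0
  have q1 : s₁.queries = [] := f1.queries
  -- the first diagonalization
  obtain ⟨g1, g2, g3, m2, g5, g6⟩ := run_diag O (dim := .reg 0) (src := 4)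
    (err := ⟨7, .lit 0, .lit 0⟩) (dstL := 8) (dstQ := 9) (s := s₁) n1 (by norm_num)
  rw [← hs₂] at g1 g2 g3 m2 g5 g6
  have e1 : s₁.get ⟨7, .lit 0, .lit 0⟩ = δ := d1
  rw [q1, e1, f1.block (by norm_num) (by norm_num), i2] at g3 g5 g6
  have n2 : s₂.reg 0 = n := by rw [g1, n1]
  -- the second query
  obtain ⟨f3, b3⟩ := run_mapPairs O (op := .div) (dst := 10) (a := 9) (b := 8) (r := 2) n2
    (by norm_num) (by norm_num) (by norm_num)
  rw [← hs₃] at f3 b3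
  have n3 : s₃.reg 0 = n := f3.reg_zero.trans n2
  have w3 : s₃.block 10 n = whitening r₀.1 r₀.2 := by
    ext i j
    refine (b3 i i.2 j j.2).trans ?_
    have h1 := congrFun (congrFun g5 j) j
    have h2 := congrFun (congrFun g6 i) j
    simp only [State.block, Matrix.of_apply, diagonal_apply_eq] at h1 h2
    rw [whitening, mul_diagonal]
    simp only [ArithOp.eval, OfNat.ofNat_ne_one, if_false, h1, h2, div_eq_mul_inv]
    rfl
  obtain ⟨f4, b4⟩ := run_addTransposeMul O (dst := 11) (a := 2) (b := 10) n3 (by norm_num)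
    (by norm_num) (by norm_num) (by norm_num) (by norm_num) (fun i j => by
      rw [f3.mem _ (by norm_num) (by norm_num), m2 _ (by norm_num) (by norm_num),
        f1.mem _ (by norm_num) (by norm_num), z _ (by norm_num)])
  rw [← hs₄] at f4 b4
  have n4 : s₄.reg 0 = n := f4.reg_zero.trans n3
  have m20 : s₂.block 2 n = x.S₁ := by
    simp only [State.block, m2 2 (by norm_num) (by norm_num)]
    rw [f1.mem _ (by norm_num) (by norm_num)]
    exact i1
  rw [w3, f3.block (by norm_num) (by norm_num), m20] at b4
  have w4 : s₄.block 10 n = whitening r₀.1 r₀.2 :=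
    (f4.block (by norm_num) (by norm_num) n).trans w3
  obtain ⟨f5, b5⟩ := run_addTransposeMul O (dst := 12) (a := 10) (b := 11) n4 (by norm_num)
    (by norm_num) (by norm_num) (by norm_num) (by norm_num) (fun i j => by
      rw [f4.mem _ (by norm_num) (by norm_num), f3.mem _ (by norm_num) (by norm_num),
        m2 _ (by norm_num) (by norm_num), f1.mem _ (by norm_num) (by norm_num),
        z _ (by norm_num)])
  rw [← hs₅] at f5 b5
  have n5 : s₅.reg 0 = n := f5.reg_zero.trans n4
  rw [w4, b4, ← Matrix.mul_assoc] at b5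
  -- the second diagonalization
  obtain ⟨k1, k2, k3, m6, k5, k6⟩ := run_diag O (dim := .reg 0) (src := 12)
    (err := ⟨7, .lit 0, .lit 0⟩) (dstL := 6) (dstQ := 13) (s := s₅) n5 (by norm_num)
  rw [← hs₆] at k1 k2 k3 m6 k5 k6
  have e5 : s₅.get ⟨7, .lit 0, .lit 0⟩ = δ := by
    simp only [State.get, State.idx]
    rw [f5.mem _ (by norm_num) (by norm_num), f4.mem _ (by norm_num) (by norm_num),
      f3.mem _ (by norm_num) (by norm_num), m2 _ (by norm_num) (by norm_num), d1]
  have q5 : s₅.queries = [⟨n, x.S₂, δ⟩] := by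
    rw [f5.queries, f4.queries, f3.queries, g3]; rfl
  rw [q5, e5, b5] at k3 k5 k6
  have n6 : s₆.reg 0 = n := by rw [k1, n5]
  -- the output
  have m06 : ∀ a, a ≠ 5 ∧ a < 6 ∨ 13 < a ∧ a ≠ 16 → s₆.mem a = s₀.mem a := by
    intro a ha
    rw [m6 _ (by omega) (by omega), f5.mem _ (by omega) (by omega),
      f4.mem _ (by omega) (by omega), f3.mem _ (by omega) (by omega),
      m2 _ (by omega) (by omega), f1.mem _ (by omega) (by omega)]
  have w6 : s₆.block 10 n = whitening r₀.1 r₀.2 := by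
    simp only [State.block, m6 10 (by norm_num) (by norm_num)]
    exact (f5.block (by norm_num) (by norm_num) n).trans w4
  obtain ⟨f7, b7⟩ := run_mapPairs O (op := .sub) (dst := 14) (a := 1) (b := 3) (r := 1) n6
    (by norm_num) (by norm_num) (by norm_num)
  rw [← hs₇] at f7 b7
  have n7 : s₇.reg 0 = n := f7.reg_zero.trans n6
  obtain ⟨f8, b8⟩ := run_addTransposeMul O (dst := 15) (a := 10) (b := 14) n7 (by norm_num)
    (by norm_num) (by norm_num) (by norm_num) (by norm_num) (fun i j => by
      rw [f7.mem _ (by norm_num) (by norm_num), m06 _ (by norm_num), z _ (by norm_num)])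
  rw [← hs₈] at f8 b8
  have n8 : s₈.reg 0 = n := f8.reg_zero.trans n7
  obtain ⟨f9, b9⟩ := run_addTransposeMul O (dst := 5) (a := 13) (b := 15) n8 (by norm_num)
    (by norm_num) (by norm_num) (by norm_num) (by norm_num) (fun i j => by
      rw [f8.mem _ (by norm_num) (by norm_num), f7.mem _ (by norm_num) (by norm_num),
        m6 _ (by norm_num) (by norm_num), f5.mem _ (by norm_num) (by norm_num),
        f4.mem _ (by norm_num) (by norm_num), f3.mem _ (by norm_num) (by norm_num),
        m2 _ (by norm_num) (by norm_num), f1.mem _ (by norm_num) (by norm_num),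
        z _ (by norm_num)])
  rw [← hs₉] at f9 b9
  have n9 : s₉.reg 0 = n := f9.reg_zero.trans n8
  obtain ⟨f10, b10⟩ := run_mapPairs O (op := .mul) (dst := 6) (a := 6) (b := 6) (r := 1) n9
    (by norm_num) (by norm_num) (by norm_num)
  rw [← hs] at f10 b10
  refine ⟨?_, ?_, ?_, ?_⟩
  · have hQ : s₈.block 13 n = r₁.2 := by
      rw [f8.block (by norm_num) (by norm_num), f7.block (by norm_num) (by norm_num), k6]
      rfl
    rw [b8, hQ, f7.block (by norm_num) (by norm_num), w6, ← Matrix.mul_assoc] at b9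
    -- Vectors are handled as matrices of which only column `0` matters; a full product stays within
    -- the cubic budget.
    have hv : (s₇.block 14 n).col ⟨0, hn⟩ = x.μ₁ - x.μ₂ := by
      ext i
      refine (b7 i i.2 0 hn).trans ?_
      rw [m06 1 (by norm_num), m06 3 (by norm_num)]
      simp [ArithOp.eval, s₀, Input.init]
    have ho : s.outMean n = (s₉.block 5 n).col ⟨0, hn⟩ := by
      ext i
      simp only [State.outMean, State.column]
      rw [f10.mem _ (by norm_num) (by norm_num)]
      rfl
    rw [ho, b9, ← hv]
    rfl
  · ext i j
    refine (b10 i i.2 j j.2).trans ?_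
    have h1 : s₉.block 6 n = diagonal r₁.1 := by
      rw [f9.block (by norm_num) (by norm_num), f8.block (by norm_num) (by norm_num),
        f7.block (by norm_num) (by norm_num), k5]
      rfl
    have h2 : s₉.mem 6 i j = diagonal r₁.1 i j := congrFun (congrFun h1 i) j
    simp only [ArithOp.eval, if_true, h2]
    by_cases hij : i = j
    · subst hij; simp [sq]
    · simp [diagonal_apply_ne _ hij]
  · exact step_bound hn f1.steps g2 f3.steps f4.steps f5.steps k2 f7.steps f8.steps f9.steps
      f10.steps
  · rw [f10.queries, f9.queries, f8.queries, f7.queries, k3]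
    rfl

end Programs

/-! ### Heights of rationals and the length of the second query. -/

section Lengths

/-- A height on the rationals that is submultiplicative for all arithmetic operations. -/
def height (q : ℚ) : ℕ := q.num.natAbs + q.den

/-- Reducing a fraction replaces numerator and denominator by divisors, except that a zero numerator
stays zero. -/
lemma height_divInt_le (a : ℤ) {b : ℤ} (hb : b ≠ 0) :
    height (Rat.divInt a b) ≤ a.natAbs + b.natAbs := by
  refine Nat.add_le_add ?_ ?_
  · rcases eq_or_ne a 0 with rfl | ha
    · simp
    · exact Nat.le_of_dvd (Int.natAbs_pos.2 ha) (Int.natAbs_dvd_natAbs.2 (Rat.num_dvd a hb))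
  · have h := Int.natAbs_dvd_natAbs.2 (Rat.den_dvd a b)
    rw [Int.natAbs_natCast] at h
    exact Nat.le_of_dvd (Int.natAbs_pos.2 hb) h

/-- Expanding `(|a| + b)(|c| + d)` yields every term of `|ad + cb| + bd`. -/
lemma height_add_le (p q : ℚ) : height (p + q) ≤ height p * height q := by
  have hp : (p.den : ℤ) ≠ 0 := by exact_mod_cast p.den_nz
  have hq : (q.den : ℤ) ≠ 0 := by exact_mod_cast q.den_nz
  have e : p + q = Rat.divInt (p.num * q.den + q.num * p.den) (p.den * q.den) := by
    conv_lhs => rw [← Rat.num_divInt_den p, ← Rat.num_divInt_den q]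
    rw [Rat.divInt_add_divInt _ _ hp hq]
  rw [e]
  refine (height_divInt_le _ (mul_ne_zero hp hq)).trans ?_
  have h1 := Int.natAbs_add_le (p.num * q.den) (q.num * p.den)
  rw [Int.natAbs_mul, Int.natAbs_mul, Int.natAbs_natCast, Int.natAbs_natCast] at h1
  rw [Int.natAbs_mul, Int.natAbs_natCast, Int.natAbs_natCast, height, height]
  have h2 := Nat.zero_le (p.num.natAbs * q.num.natAbs)
  nlinarith

lemma height_mul_le (p q : ℚ) : height (p * q) ≤ height p * height q := by
  have hp : (p.den : ℤ) ≠ 0 := by exact_mod_cast p.den_nz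
  have hq : (q.den : ℤ) ≠ 0 := by exact_mod_cast q.den_nz
  have e : p * q = Rat.divInt (p.num * q.num) (p.den * q.den) := by
    conv_lhs => rw [← Rat.num_divInt_den p, ← Rat.num_divInt_den q]
    rw [Rat.divInt_mul_divInt]
  rw [e]
  refine (height_divInt_le _ (mul_ne_zero hp hq)).trans ?_
  rw [Int.natAbs_mul, Int.natAbs_mul, Int.natAbs_natCast, Int.natAbs_natCast, height, height]
  nlinarith [Nat.zero_le (p.num.natAbs * q.den), Nat.zero_le (p.den * q.num.natAbs)]

lemma height_inv_le (q : ℚ) : height q⁻¹ ≤ height q := by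
  rcases eq_or_ne q 0 with rfl | hq
  · simp
  · rw [Rat.inv_def]
    refine (height_divInt_le _ (Rat.num_ne_zero.2 hq)).trans ?_
    rw [Int.natAbs_natCast, height, add_comm]

lemma height_sum_le {n B : ℕ} {f : Fin n → ℚ} (h : ∀ i, height (f i) ≤ 2 ^ B) :
    height (∑ i, f i) ≤ 2 ^ (n * B) := by
  induction n with
  | zero => simp [height]
  | succ n ih =>
    rw [Fin.sum_univ_castSucc]
    refine (height_add_le _ _).trans ?_
    rw [add_mul, one_mul, pow_add]
    exact Nat.mul_le_mul (ih fun i => h _) (h _)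

lemma height_le_two_pow_len (q : ℚ) : height q ≤ 2 ^ len q := by
  have h1 : q.num.natAbs ≤ 2 ^ (Nat.size q.num.natAbs + Nat.size q.den) :=
    (Nat.lt_size_self _).le.trans (Nat.pow_le_pow_right (by norm_num) (Nat.le_add_right _ _))
  have h2 : q.den ≤ 2 ^ (Nat.size q.num.natAbs + Nat.size q.den) :=
    (Nat.lt_size_self _).le.trans (Nat.pow_le_pow_right (by norm_num) (Nat.le_add_left _ _))
  rw [len, add_assoc, pow_add, height]
  omega

/-- Numerator and denominator need at most `B + 1` bits each, plus one for the sign. -/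
lemma len_le_of_height_le {q : ℚ} {B : ℕ} (h : height q ≤ 2 ^ B) : len q ≤ 2 * B + 3 := by
  have h0 : 2 ^ B < 2 ^ (B + 1) := Nat.pow_lt_pow_right (by norm_num) (by omega)
  rw [height] at h
  have h1 : Nat.size q.num.natAbs ≤ B + 1 := Nat.size_le.2 (by omega)
  have h2 : Nat.size q.den ≤ B + 1 := Nat.size_le.2 (by omega)
  rw [len]
  omega

variable {n : ℕ}

lemma len_le_lenVec (v : Fin n → ℚ) (i : Fin n) : len (v i) ≤ lenVec v :=
  Finset.single_le_sum (f := fun i => len (v i)) (fun _ _ => Nat.zero_le _) (Finset.mem_univ i)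

lemma len_le_lenMat (A : Matrix (Fin n) (Fin n) ℚ) (i j : Fin n) : len (A i j) ≤ lenMat A :=
  (len_le_lenVec (A i) j).trans
    (Finset.single_le_sum (f := fun i => lenVec (A i)) (fun _ _ => Nat.zero_le _)
      (Finset.mem_univ i))

lemma lenMat_le {A : Matrix (Fin n) (Fin n) ℚ} {B : ℕ} (h : ∀ i j, height (A i j) ≤ 2 ^ B) :
    lenMat A ≤ n ^ 2 * (2 * B + 3) := by
  refine (Finset.sum_le_sum fun i _ => Finset.sum_le_sum fun j _ =>
    len_le_of_height_le (h i j)).trans (le_of_eq ?_)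
  simp
  ring

lemma height_mul_apply_le {A B : Matrix (Fin n) (Fin n) ℚ} {a b : ℕ}
    (hA : ∀ i j, height (A i j) ≤ 2 ^ a) (hB : ∀ i j, height (B i j) ≤ 2 ^ b) (i j : Fin n) :
    height ((A * B) i j) ≤ 2 ^ (n * (a + b)) := by
  rw [Matrix.mul_apply]
  refine height_sum_le fun k => (height_mul_le _ _).trans ?_
  rw [pow_add]
  exact Nat.mul_le_mul (hA i k) (hB k j)

lemma polynomial_eval_mono (p : Polynomial ℕ) {a b : ℕ} (h : a ≤ b) : p.eval a ≤ p.eval b := by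
  rw [Polynomial.eval_eq_sum_range, Polynomial.eval_eq_sum_range]
  exact Finset.sum_le_sum fun i _ => Nat.mul_le_mul_left _ (Nat.pow_le_pow_left h i)

/-- Length of the second query in terms of the first answer. -/
lemma lenMat_second_query_le {l : Fin n → ℚ} {Q S : Matrix (Fin n) (Fin n) ℚ} {N P : ℕ}
    (hlQ : lenVec l + lenMat Q ≤ P) (hS : lenMat S ≤ N) (hn : n ≤ N) :
    lenMat ((whitening l Q).transpose * S * whitening l Q) ≤
      N ^ 2 * (2 * (N * (N * (2 * P + N) + 2 * P)) + 3) := by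
  -- An entry is one entry of `Q` times the inverse of one entry of `l`, each of height at most `2 ^
  -- P`.
  have hW : ∀ i j, height (whitening l Q i j) ≤ 2 ^ (2 * P) := by
    intro i j
    rw [whitening, Matrix.mul_diagonal, two_mul, pow_add]
    refine (height_mul_le _ _).trans (Nat.mul_le_mul ?_ ((height_inv_le _).trans ?_))
    · refine (height_le_two_pow_len _).trans (Nat.pow_le_pow_right (by norm_num) ?_)
      have := len_le_lenMat Q i j
      omega
    · refine (height_le_two_pow_len _).trans (Nat.pow_le_pow_right (by norm_num) ?_)
      have := len_le_lenVec l j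
      omega
  have hS' : ∀ i j, height (S i j) ≤ 2 ^ N := fun i j =>
    (height_le_two_pow_len _).trans
      (Nat.pow_le_pow_right (by norm_num) ((len_le_lenMat S i j).trans hS))
  have h1 := height_mul_apply_le (A := (whitening l Q).transpose) (fun i j => hW j i) hS'
  refine (lenMat_le (height_mul_apply_le h1 hW)).trans ?_
  gcongr

end Lengths

/-! ### Assembly of the theorem. -/

/-- In dimension zero the only events are the empty set and the whole space, so `D = 0`, against `0
< Δ ≤ D`. -/
lemma Input.Admissible.dim_pos {n : ℕ} {x : Input n} (hx : x.Admissible) : 0 < n := by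
  rcases Nat.eq_zero_or_pos n with rfl | h
  · exfalso
    have h1 : x.D ≤ 0 := by
      refine tvDist_le fun A _ => ?_
      rcases Set.eq_empty_or_nonempty A with rfl | hA
      · simp
      · rw [Subsingleton.eq_univ_of_nonempty hA]
        simp
    have h2 := hx.Δ_le
    have h3 : (0 : ℝ) < x.Δ := by exact_mod_cast hx.Δ_pos
    linarith
  · exact h

end GaussTV

theorem mainTheorem6 (δ₀ : ℝ) (hδ₀ : 0 < δ₀) :
    ∃ (P : GaussTV.Prog) (C : ℕ) (c : ℚ) (k : ℕ), 0 < c ∧ 0 < k ∧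
      ∀ p : Polynomial ℕ, ∃ r : Polynomial ℕ,
        ∀ O : GaussTV.Oracle, O.Valid δ₀ p →
          ∀ (n : ℕ) (x : GaussTV.Input n), x.Admissible →
            let s := P.run O x.init
            let δ : ℚ := c * (min x.ε 1 * x.Δ / (n * x.κ)) ^ k
            -- the output and its accuracy
            (s.outCov n).IsDiag ∧
            (GaussTV.toReal (s.outCov n)).PosDef ∧
            |x.D - GaussTV.tvDist (GaussTV.gaussian (s.outMean n) (s.outCov n))
                (GaussTV.gaussian 0 1)| ≤ (x.ε : ℝ) / 100 * x.D ∧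
            -- the number of arithmetic operations
            s.steps ≤ C * n ^ 3 ∧
            -- the calls to the oracle
            s.queries.length = 2 ∧
            ∀ q ∈ s.queries, q.dim = n ∧ (GaussTV.toReal q.mat).PosDef ∧
              GaussTV.lenMat q.mat ≤ r.eval (n + x.length + GaussTV.len δ) ∧
              q.err = δ := by
  open GaussTV in
  -- The bound `δ₀` keeps `δ` in the oracle's range, and `1 / 40000` is `1 / 100` divided by the
  -- constant `400` of the accuracy bound.
  obtain ⟨c, hc0, hc1⟩ := exists_rat_btwn (show (0 : ℝ) < min δ₀ (1 / 40000) by positivity)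
  have hcδ : (c : ℝ) ≤ δ₀ := hc1.le.trans (min_le_left _ _)
  have hc2 : (c : ℝ) ≤ 1 / 40000 := hc1.le.trans (min_le_right _ _)
  have hc0' : 0 < c := by exact_mod_cast hc0
  -- The exponent `2` matches the loss `κ²`: then `n δ κ² ≤ c · min(ε, 1) Δ`.
  refine ⟨reduction c, 100, c, 2, hc0', two_pos, fun p => ?_⟩
  -- The summand `X` covers the first query, the other one the second.
  refine ⟨Polynomial.X + Polynomial.X ^ 2 * (2 * (Polynomial.X * (Polynomial.X *
    (2 * p + Polynomial.X) + 2 * p)) + 3), fun O hO n x hx => ?_⟩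
  intro s δ
  have hn : 0 < n := hx.dim_pos
  have hrun := run_reduction O c hn x
  change let r₀ := O 0 n x.S₂ δ
    let A := (whitening r₀.1 r₀.2).transpose * x.S₁.transpose * whitening r₀.1 r₀.2
    let r₁ := O 1 n A δ
    s.outMean n = (r₁.2.transpose * (whitening r₀.1 r₀.2).transpose).mulVec (x.μ₁ - x.μ₂) ∧
    s.outCov n = Matrix.diagonal (fun i => r₁.1 i ^ 2) ∧ s.steps ≤ 100 * n ^ 3 ∧
    s.queries = [⟨n, x.S₂, δ⟩, ⟨n, A, δ⟩] at hrun
  clear_value s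
  -- The program only forms products with a transposed left factor, so `Σ₁` enters transposed.
  have hsymm : x.S₁.transpose = x.S₁ := by
    have h := transpose_eq_of_posDef hx.posDef₁
    ext i j
    have h1 := congrFun (congrFun h i) j
    simpa [toReal] using h1
  rw [hsymm] at hrun
  -- size of the error parameter
  have hn1 : (1 : ℝ) ≤ n := by exact_mod_cast hn
  have hκ : (1 : ℝ) < x.κ := by exact_mod_cast hx.one_lt_κ
  have hε : (0 : ℝ) < x.ε := by exact_mod_cast hx.eps_pos
  have hΔ : (0 : ℝ) < x.Δ := by exact_mod_cast hx.Δ_pos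
  have hΔ1 : (x.Δ : ℝ) ≤ 1 := hx.Δ_le.trans (tvDist_le_one _ _)
  set t : ℝ := min (x.ε : ℝ) 1 * x.Δ with ht
  have hmin : 0 < min (x.ε : ℝ) 1 := lt_min hε one_pos
  have ht0 : 0 < t := mul_pos hmin hΔ
  have ht1 : t ≤ 1 := mul_le_one₀ (min_le_right _ _) hΔ.le hΔ1
  have hδt : (δ : ℝ) * ((n : ℝ) * x.κ) ^ 2 = c * t ^ 2 := by
    simp only [δ, ht]
    push_cast
    have : (n : ℝ) * x.κ ≠ 0 := by positivity
    field_simp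
  clear_value δ
  have hδ0 : 0 < δ := by
    have h1 : (0 : ℝ) < δ := by
      have h2 : 0 < (δ : ℝ) * ((n : ℝ) * x.κ) ^ 2 := by rw [hδt]; positivity
      exact pos_of_mul_pos_left h2 (by positivity)
    exact_mod_cast h1
  have hδ0' : (0 : ℝ) < δ := by exact_mod_cast hδ0
  have ht2 : t ^ 2 ≤ t := by nlinarith
  have hκ2 : (1 : ℝ) ≤ x.κ ^ 2 := by nlinarith
  have hnκ : (n : ℝ) * (δ * x.κ ^ 2) ≤ c * t := by
    have h1 : 0 ≤ (δ : ℝ) * x.κ ^ 2 := by positivity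
    have h2 : (δ : ℝ) * ((n : ℝ) * x.κ) ^ 2 = n * (n * (δ * x.κ ^ 2)) := by ring
    have h3 : (n : ℝ) * (δ * x.κ ^ 2) ≤ n * (n * (δ * x.κ ^ 2)) :=
      le_mul_of_one_le_left (by positivity) hn1
    have h4 : (c : ℝ) * t ^ 2 ≤ c * t := mul_le_mul_of_nonneg_left ht2 hc0.le
    linarith
  have hct : (c : ℝ) * t ≤ c := mul_le_of_le_one_right hc0.le ht1
  have hδκ : (δ : ℝ) * x.κ ^ 2 ≤ c := by
    have h3 : (δ : ℝ) * x.κ ^ 2 ≤ n * (δ * x.κ ^ 2) := le_mul_of_one_le_left (by positivity) hn1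
    linarith
  have hδδ : (δ : ℝ) ≤ δ₀ := by
    have := le_mul_of_one_le_right hδ0'.le hκ2
    linarith
  obtain ⟨hmean, hcov, hsteps, hqueries⟩ := hrun
  obtain ⟨hd₀, hlen₀⟩ := hO 0 n x.S₂ δ hx.posDef₂ hδ0 hδδ
  generalize O 0 n x.S₂ δ = r₀ at *
  -- Positive definiteness of the second query is needed before the oracle's guarantee applies to
  -- it; only then is the accuracy bound used with the second answer.
  obtain ⟨hApos, hacc⟩ := reduction_accuracy hn hx hδ0 (by linarith) hd₀
  set A := (whitening r₀.1 r₀.2).transpose * x.S₁ * whitening r₀.1 r₀.2 with hA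
  obtain ⟨hd₁, -⟩ := hO 1 n A δ hApos hδ0 hδδ
  generalize O 1 n A δ = r₁ at *
  obtain ⟨hl', hacc⟩ := hacc hd₁
  refine ⟨?_, ?_, ?_, hsteps, ?_, ?_⟩
  · rw [hcov]
    exact Matrix.isDiag_diagonal _
  · rw [hcov, toReal_diagonal, Matrix.posDef_diagonal_iff]
    intro i
    have : (0 : ℝ) < r₁.1 i := by exact_mod_cast hl' i
    push_cast
    positivity
  · rw [hcov, hmean]
    refine hacc.trans ?_
    have h1 : t ≤ x.ε * x.D :=
      mul_le_mul (min_le_left _ _) hx.Δ_le hΔ.le hε.le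
    have h2 : (c : ℝ) * t ≤ 1 / 40000 * t := mul_le_mul_of_nonneg_right hc2 ht0.le
    linarith
  · rw [hqueries]
    rfl
  · rw [hqueries]
    set N := n + x.length + len δ with hN
    have hS₁ : lenMat x.S₁ ≤ N := by simp only [hN, Input.length]; omega
    have hS₂ : lenMat x.S₂ ≤ N := by simp only [hN, Input.length]; omega
    have hlen : lenVec r₀.1 + lenMat r₀.2 ≤ p.eval N :=
      hlen₀.trans (polynomial_eval_mono p (by simp only [hN, Input.length]; omega))
    have hlenA := lenMat_second_query_le hlen hS₁ (by omega)
    simp only [Polynomial.eval_add, Polynomial.eval_mul, Polynomial.eval_pow, Polynomial.eval_X,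
      Polynomial.eval_ofNat]
    intro q hq
    simp only [List.mem_cons, List.not_mem_nil, or_false] at hq
    rcases hq with rfl | rfl
    · exact ⟨rfl, hx.posDef₂, hS₂.trans (Nat.le_add_right _ _), rfl⟩
    · exact ⟨rfl, hApos, hlenA.trans (Nat.le_add_left _ _), rfl⟩
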